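/- Terminology. A good type is a sequence $\tau=\langle m_k,n_{k+1},r_{k+1}\rangle_{k\in\omega}$ of natural numbers with $m_0=1$, $n_{k+1}\ge 2$, $r_{k+1}<m_k$ and $m_{k+1}=r_{k+1}+(m_k-r_{k+1})n_{k+1}$, in which every $r\in\omega$ equals $r_k$ for infinitely many $k$. For finite sets of ordinals, $X<Y$ means that every element of $X$ is below every element of $Y$. A construction scheme over $\omega_1$ of type $\tau$ is a cofinal family $\mathcal F$ of nonempty finite subsets of $\omega_1$, each of cardinality some $m_k$, such that with $\mathcal F_k=\{F\in\mathcal F:|F|=m_k\}$: (i) for $E,F\in\mathcal F_k$, $E\cap F$ is an initial segment of both $E$ and $F$; (ii) every $F\in\mathcal F_{k+1}$ is a union $\bigcup_{i<n_{k+1}}F_i$ of members of $\mathcal F_k$ that form a $\Delta$-system with root $R(F)$, where $|R(F)|=r_{k+1}$ and $R(F)<F_0\setminus R(F)<\dots<F_{n_{k+1}-1}\setminus R(F)$ (such $F_i$ are unique). For $\alpha,\beta\in\omega_1$ put $\rho(\alpha,\beta)=\min\{k:\exists F\in\mathcal F_k\ \{\alpha,\beta\}\subseteq F\}$ and $\|\alpha\|_k=|\{\xi<\alpha:\rho(\alpha,\xi)\le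 k\}|$; let $\Delta(\alpha,\beta)$ be the least $k$ with $\|\alpha\|_k\ne\|\beta\|_k$ (and $\omega$ if there is none). Put $\Xi_\alpha(0)=0$, and for $k\ge1$ let $\Xi_\alpha(k)=-1$ if $\alpha\in R(F)$ and $\Xi_\alpha(k)=i$ if $\alpha\in F_i\setminus R(F)$, for any $F\in\mathcal F_k$ containing $\alpha$ (the choice of $F$ does not matter). Let $D(a)$ denote the $a$-th element of $D$, counting from $0$. A $\Delta$-system $\langle D_i\rangle_{i<n}$ ($n\geq 2$) of distinct finite subsets of $\omega_1$ of one size $m\ge1$, with root $R$ of size $r$, such that $R<D_i\setminus R$ for all $i$ and, for $i\ne j$, $D_i\setminus R<D_j\setminus R$ or vice versa, is captured at level $l$ if $\Xi_{D_i(a)}(l)=-1$ for $a<r$, $\Xi_{D_i(a)}(l)=i$ for $r\le a<m$, and $\rho(D_i(a),D_j(a))=l=\Delta(D_i(a),D_j(a))$ for $i<j<n$ and $r\le a<m$. A set $D\subseteq\omega_1$ of size $n$ is captured at level $l$ if the family of its singletons is, in some enumeration. $\mathcal F$ is $n$-capturing if for every uncountable family $\mathcal S$ of nonempty finite subsets of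 $\omega_1$ there are infinitely many $l\in\omega$ such that some $n$-element subset of $\mathcal S$ is, in some enumeration, captured at level $l$. For a (nonempty) forcing notion $\mathbb P$, let $\mathfrak m(\mathbb P)$ be the least cardinality of a family of dense subsets of $\mathbb P$ that no filter meets ($\infty$ if there is none). For $n$-capturing $\mathcal F$, let $\mathfrak m^n_{\mathcal F}$ be the minimum of $\mathfrak m(\mathbb P)$ over all ccc forcing notions $\mathbb P$ with $\mathbb P\Vdash$ "$\mathcal F$ is $n$-capturing" (and $\mathfrak m^n_{\mathcal F}=\omega$ if $\mathcal F$ is not $n$-capturing). For $S\subseteq\omega_1$ let $\pi_n(S)$ be the set of all $l\in\omega$ such that some $n$-element $D\subseteq S$ is captured at level $l$, and let $\mathcal U_n(\mathcal F)$ be the set of all $A\subseteq\omega$ with $\pi_n(S)\subseteq A$ for some uncountable $S\subseteq\omega_1$. A nonprincipal ultrafilter $\mathcal U$ on $\omega$ is Ramsey if for every infinite partition $\mathcal P$ of $\omega$ into sets whose complements are in $\mathcal U$ there is $A\in\mathcal U$ with $|A\cap P|\le1$ for all $P\in\mathcal P$. Theorem. Let $2\le n\in\omega$, and let $\mathcal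 F$ be an $n$-capturing construction scheme over $\omega_1$ of a good type such that $\mathfrak m^n_{\mathcal F}>\omega_1$. Then $\mathcal U_n(\mathcal F)$ is a (nonprincipal) Ramsey ultrafilter on $\omega$. -/

import Mathlib

open Cardinal

noncomputable section

namespace Scheme

/-- The first uncountable ordinal, as a well-ordered type. -/
abbrev OmegaOne : Type := (Ordinal.omega.{0} 1).ToType

/-- The family `Fin(X)` of nonempty finite subsets of `X`. -/
abbrev NFin (X : Type) : Type := {s : Finset X // s.Nonempty}

/-- `X < Y` for finite sets of ordinals: every element of `X` is below every element of `Y`. -/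
def Below (X Y : Finset OmegaOne) : Prop := ∀ x ∈ X, ∀ y ∈ Y, x < y

/-- `X ⊑ Y`: `X` is an initial segment of `Y`. -/
def InitSeg (X Y : Finset OmegaOne) : Prop := X ⊆ Y ∧ ∀ x ∈ X, ∀ y ∈ Y, y < x → y ∈ X

/-! ### Construction schemes -/

/-- A good type `⟨m_k, n_{k+1}, r_{k+1}⟩`. The values `n 0` and `r 0` are not used. -/
structure GoodType where
  m : ℕ → ℕ
  n : ℕ → ℕ
  r : ℕ → ℕ
  m_zero : m 0 = 1
  two_le_n : ∀ k, 2 ≤ n (k + 1)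
  r_lt_m : ∀ k, r (k + 1) < m k
  m_succ : ∀ k, m (k + 1) = r (k + 1) + (m k - r (k + 1)) * n (k + 1)
  good : ∀ a, {k | r (k + 1) = a}.Infinite

variable (τ : GoodType) (F : Set (Finset OmegaOne))

/-- The level `F_k`, consisting of the members of `F` of cardinality `m_k`. -/
def level (k : ℕ) : Set (Finset OmegaOne) := {A | A ∈ F ∧ A.card = τ.m k}

/-- `⟨A_i⟩_{i < n_{k+1}}` is a decomposition of `A` into members of `F_k` that form a `Δ`-system
with root `R`, where `|R| = r_{k+1}` and `R < A_0 \ R < A_1 \ R < ⋯`. -/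
structure IsDecomposition (k : ℕ) (A : Finset OmegaOne)
    (part : Fin (τ.n (k + 1)) → Finset OmegaOne) (R : Finset OmegaOne) : Prop where
  mem_level : ∀ i, part i ∈ level τ F k
  union : A = Finset.univ.biUnion part
  inter : ∀ i j, i ≠ j → part i ∩ part j = R
  card_root : R.card = τ.r (k + 1)
  root_below : ∀ i, Below R (part i \ R)
  tails_below : ∀ i j, i < j → Below (part i \ R) (part j \ R)

/-- `F` is a construction scheme over `ω₁` of type `τ`. -/
structure IsConstructionScheme : Prop where
  nonempty : ∀ A ∈ F, A.Nonempty
  cofinal : ∀ A : Finset OmegaOne, A.Nonempty → ∃ B ∈ F, A ⊆ B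
  card_mem : ∀ A ∈ F, ∃ k, A.card = τ.m k
  inter_initSeg : ∀ k, ∀ A ∈ level τ F k, ∀ B ∈ level τ F k,
    InitSeg (A ∩ B) A ∧ InitSeg (A ∩ B) B
  decomposition : ∀ k, ∀ A ∈ level τ F (k + 1), ∃ part R, IsDecomposition τ F k A part R

/-! ### The functions associated with a scheme -/

/-- `ρ(α, β)`, the least `k` such that `{α, β}` is covered by a member of `F_k`. -/
def rho (α β : OmegaOne) : ℕ := sInf {k | ∃ A ∈ level τ F k, α ∈ A ∧ β ∈ A}

/-- `‖α‖_k`, the number of `ξ < α` with `ρ(α, ξ) ≤ k`. -/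
def cardFun (α : OmegaOne) (k : ℕ) : ℕ := {ξ | ξ < α ∧ rho τ F α ξ ≤ k}.ncard

/-- `Δ(α, β)`, the least `k` with `‖α‖_k ≠ ‖β‖_k`, and `ω` (that is, `⊤`) if there is none. -/
def Del (α β : OmegaOne) : ℕ∞ :=
  ⨅ (k : ℕ) (_ : cardFun τ F α k ≠ cardFun τ F β k), (k : ℕ∞)

/-- The graph of `Ξ_α`: the value at `0` is `0`; the value at `k + 1`, computed from some
`A ∈ F_{k+1}` with `α ∈ A`, is `-1` if `α` is in the root of `A`, and `i` if `α ∈ A_i \ R(A)`. -/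
def XiGraph (α : OmegaOne) : ℕ → ℤ → Prop
  | 0, v => v = 0
  | k + 1, v => ∃ A ∈ level τ F (k + 1), α ∈ A ∧ ∃ part R, IsDecomposition τ F k A part R ∧
      ((α ∈ R ∧ v = -1) ∨ ∃ i, α ∈ part i \ R ∧ v = (i : ℕ))

open Classical in
/-- `Ξ_α(k)`. For a construction scheme `XiGraph` is the graph of a total function, so that the
second case does not occur. -/
def Xi (α : OmegaOne) (k : ℕ) : ℤ :=
  if h : ∃ v, XiGraph τ F α k v then h.choose else 0

/-! ### Capturing -/

/-- `⟨D_i⟩_{i < n}` is a root-tail-tail `Δ`-system with root `R`. -/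
structure IsRootTailTail {n : ℕ} (D : Fin n → Finset OmegaOne) (R : Finset OmegaOne) : Prop where
  two_le : 2 ≤ n
  injective : Function.Injective D
  inter : ∀ i j, i ≠ j → D i ∩ D j = R
  root_below : ∀ i, Below R (D i \ R)
  tails : ∀ i j, i ≠ j → Below (D i \ R) (D j \ R) ∨ Below (D j \ R) (D i \ R)

/-- The system `⟨D_i⟩_{i < n}` is captured at level `l`; here `orderEmbOfFin` gives the `a`-th
element `D_i(a)` of `D_i`. -/
def Captured {n : ℕ} (D : Fin n → Finset OmegaOne) (l : ℕ) : Prop :=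
  ∃ (m : ℕ) (hm : ∀ i, (D i).card = m) (R : Finset OmegaOne), 1 ≤ m ∧ IsRootTailTail D R ∧
    (∀ (i : Fin n) (a : Fin m),
      Xi τ F ((D i).orderEmbOfFin (hm i) a) l = if (a : ℕ) < R.card then -1 else ((i : ℕ) : ℤ)) ∧
    ∀ (i j : Fin n), i < j → ∀ a : Fin m, R.card ≤ (a : ℕ) →
      rho τ F ((D i).orderEmbOfFin (hm i) a) ((D j).orderEmbOfFin (hm j) a) = l ∧
      Del τ F ((D i).orderEmbOfFin (hm i) a) ((D j).orderEmbOfFin (hm j) a) = (l : ℕ∞)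

/-- `F` is `n`-capturing: for every uncountable `S ⊆ Fin(ω₁)` there are infinitely many `l` such
that some `D ∈ [S]^n` is captured at level `l`. -/
def IsCapturing (n : ℕ) : Prop :=
  ∀ S : Set (NFin OmegaOne), ¬ S.Countable → ∀ k : ℕ, ∃ l : ℕ, k < l ∧
    ∃ D : Fin n → NFin OmegaOne, Captured τ F (fun i => (D i).1) l ∧ ∀ i, D i ∈ S

/-! ### Forcing

Statements of the forcing language are represented by the sets of conditions that force them, and
the logical operations follow the usual recursive clauses of the forcing relation (stronger
conditions are smaller). A set of pairs `σ ⊆ P × X` is a name for a subset of the ground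
model set `X`; in a generic extension by `G` it denotes `{x | ∃ s ∈ G, (s, x) ∈ σ}`, and every
subset of `X` in the extension has such a name. -/

section Forcing

variable {P : Type} [Preorder P]

/-- A statement of the forcing language, as the set of conditions that force it. -/
abbrev FStat (P : Type) : Type := P → Prop

/-- Names for subsets of the ground model set `X`. -/
abbrev SubsetName (P X : Type) : Type := Set (P × X)

/-- A statement about the ground model that is absolute. -/
def fCheck (a : Prop) : FStat P := fun _ => a

/-- `x ∈ σ`. -/
def fMem {X : Type} (x : X) (σ : SubsetName P X) : FStat P :=
  fun p => ∀ q ≤ p, ∃ t ≤ q, ∃ s, t ≤ s ∧ (s, x) ∈ σ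

def fNot (φ : FStat P) : FStat P := fun p => ∀ q ≤ p, ¬ φ q

def fAnd (φ ψ : FStat P) : FStat P := fun p => φ p ∧ ψ p

def fImp (φ ψ : FStat P) : FStat P := fun p => ∀ q ≤ p, φ q → ψ q

def fAll {I : Type} (φ : I → FStat P) : FStat P := fun p => ∀ i, φ i p

def fEx {I : Type} (φ : I → FStat P) : FStat P := fun p => ∀ q ≤ p, ∃ t ≤ q, ∃ i, φ i t

/-- "`σ` is countable": there is a partial function `e` from `ω` to `X` whose range covers `σ`. -/
def fCountable {X : Type} (σ : SubsetName P X) : FStat P :=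
  fEx fun e : SubsetName P (ℕ × X) =>
    fAnd
      (fAll fun k : ℕ => fAll fun x : X => fAll fun y : X =>
        fImp (fAnd (fMem (k, x) e) (fMem (k, y) e)) (fCheck (x = y)))
      (fAll fun x : X => fImp (fMem x σ) (fEx fun k : ℕ => fMem (k, x) e))

/-- "`F` is `n`-capturing". Finite subsets of `ω₁` are those of the ground model, which is correct
for forcings that preserve `ω₁`. -/
def fCapturing (n : ℕ) : FStat P :=
  fAll fun S : SubsetName P (NFin OmegaOne) =>
    fImp (fNot (fCountable S)) <|
      fAll fun k : ℕ => fEx fun l : ℕ => fAnd (fCheck (k < l)) <|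
        fEx fun D : Fin n → NFin OmegaOne =>
          fAnd (fCheck (Captured τ F (fun i => (D i).1) l)) (fAll fun i => fMem (D i) S)

variable (P)

/-- The countable chain condition: every antichain (set of pairwise incompatible conditions) is
countable. -/
def IsCCC : Prop := ∀ A : Set P, IsStrongAntichain (· ≥ ·) A → A.Countable

/-- `P` `n`-preserves `F`: every condition forces that `F` is `n`-capturing. -/
def Preserves (n : ℕ) : Prop := ∀ p : P, fCapturing τ F n p

/-- The Martin's number `𝔪(P)`: the least cardinality of a family of dense sets that no filter
meets, and `⊤` if there is no such family. -/
def martinNumber : WithTop Cardinal.{0} :=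
  ⨅ (E : Set (Set P)) (_ : (∀ D ∈ E, IsCoinitial D) ∧
    ¬ ∃ G : Order.PFilter P, ∀ D ∈ E, ∃ p ∈ D, p ∈ G), ((#E : Cardinal.{0}) : WithTop Cardinal.{0})

end Forcing

open Classical in
/-- The parametrized Martin's number `𝔪ⁿ_F`. Forcing notions are nonempty. -/
def schemeMartinNumber (n : ℕ) : WithTop Cardinal.{0} :=
  if IsCapturing τ F n then
    ⨅ (P : Type) (_ : Preorder P) (_ : Nonempty P) (_ : IsCCC P) (_ : Preserves τ F P n),
      martinNumber P
  else ((ℵ₀ : Cardinal.{0}) : WithTop Cardinal.{0})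

/-! ### The projection filter and Ramsey ultrafilters -/

/-- The `n`-projection `π_n(S)`: the levels at which some `D ∈ [S]^n`, that is, the increasing
system of the singletons of its elements, is captured. -/
def proj (n : ℕ) (S : Set OmegaOne) : Set ℕ :=
  {l | ∃ α : Fin n → OmegaOne, (∀ i, α i ∈ S) ∧ Captured τ F (fun i => {α i}) l}

/-- `𝒰_n(F)`: the sets that contain `π_n(S)` for some uncountable `S ⊆ ω₁`. -/
def projFilter (n : ℕ) : Set (Set ℕ) :=
  {A | ∃ S : Set OmegaOne, ¬ S.Countable ∧ proj τ F n S ⊆ A}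

/-- A nonprincipal ultrafilter `U` on `ω` is Ramsey if every infinite partition of `ω` into sets
of the dual ideal has a partial selector in `U`. -/
def IsRamsey (U : Ultrafilter ℕ) : Prop :=
  (∀ k : ℕ, {k}ᶜ ∈ U) ∧
  ∀ Q : Set (Set ℕ), Q.Infinite → Setoid.IsPartition Q → (∀ B ∈ Q, Bᶜ ∈ U) →
    ∃ A ∈ U, ∀ B ∈ Q, (A ∩ B).Subsingleton

end Scheme

end

noncomputable section

namespace Scheme


/-! ### The first uncountable ordinal -/

/-! The members of a level are isomorphic as ordered sets with `rho` (`rho_eq_of_pos_eq`). Hence,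
when points `α i` are captured at level `l`, distinct nonempty finite sets occupying the same
positions in the closures of the `α i` at a fixed level below `l` are captured at `l` as well
(`captured_of_isSpread`). An uncountable family of finite sets can thus be handled through single
points, once countably many parameters have been stabilised. Applied to points `f x ∈ S` above `x ∈
T`, this makes the projections a filter base (`exists_proj_subset_inter`).

Martin's number enters through properties `Ψ` of sets of levels that are extendible
(`IsExtendible`), and the forcing of finite sets `p` with `Ψ (proj p)`. The core is
`exists_amalgam`: given uncountably many conditions, some `n` of them sit alike below captured
points, and their union gains only the capturing level (`proj_biUnion_subset`), which extendibility
allows to be chosen so that `Ψ` survives. This yields the countable chain condition, preservation of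
`n`-capturing and, below some condition, an unbounded generic set. Meeting `ℵ₁` dense sets produces
an uncountable `S` all of whose finite subsets satisfy `Ψ`.

Two properties suffice. "Contained in `A`" is extendible as soon as `Aᶜ` is not in the filter, which
gives an ultrafilter. "At most one point in each block" is extendible because finitely many blocks
can be avoided by a set in the ultrafilter, which gives the Ramsey property. -/

theorem mk_omegaOne : #OmegaOne = ℵ₁ := by simp [OmegaOne]

theorem countable_Iio (ξ : OmegaOne) : (Set.Iio ξ).Countable := by
  have h : #(Set.Iio ξ) < ℵ₁ := by
    rw [← mk_omegaOne]
    exact Cardinal.mk_Iio_lt ξ (by rw [mk_omegaOne, Cardinal.ord_aleph, Ordinal.type_toType])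
  rwa [← Cardinal.le_aleph0_iff_set_countable, ← Order.lt_succ_iff, Cardinal.succ_aleph0]

theorem countable_Iic (ξ : OmegaOne) : (Set.Iic ξ).Countable := by
  rw [← Set.Iio_insert]
  exact (countable_Iio ξ).insert ξ

theorem not_countable_univ : ¬ (Set.univ : Set OmegaOne).Countable := by
  rw [← Cardinal.le_aleph0_iff_set_countable, Cardinal.mk_univ, mk_omegaOne, not_le]
  exact Cardinal.aleph0_lt_aleph_one

theorem exists_gt_of_not_countable {S : Set OmegaOne} (hS : ¬ S.Countable) (ξ : OmegaOne) :
    ∃ α ∈ S, ξ < α := by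
  by_contra! h
  exact hS ((countable_Iic ξ).mono h)

theorem exists_gt_of_countable {S : Set OmegaOne} (hS : S.Countable) : ∃ ξ, ∀ α ∈ S, α < ξ := by
  by_contra! h
  refine not_countable_univ ((hS.biUnion fun α _ => countable_Iic α).mono ?_)
  intro ξ _
  obtain ⟨α, hα, h⟩ := h ξ
  exact Set.mem_biUnion hα h

/-- A function with values in a countable type is constant on an index set on which the
function `f` still has uncountable range. -/
theorem exists_uncountable_image_fiber {I X C : Type*} [Countable C] (f : I → X)
    (hf : ¬ (Set.range f).Countable) (c : I → C) : ∃ a, ¬ (f '' {i | c i = a}).Countable := by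
  by_contra! h
  refine hf ((Set.countable_iUnion h).mono ?_)
  rintro _ ⟨i, rfl⟩
  exact Set.mem_iUnion.2 ⟨c i, i, rfl, rfl⟩

/-- The number of elements of `E` below `x`. -/
def pos (E : Finset OmegaOne) (x : OmegaOne) : ℕ := (E.filter (· < x)).card

theorem pos_mono (E : Finset OmegaOne) {x y : OmegaOne} (h : x ≤ y) : pos E x ≤ pos E y :=
  Finset.card_le_card fun z hz => by
    simp only [Finset.mem_filter] at hz ⊢
    exact ⟨hz.1, hz.2.trans_le h⟩

theorem pos_lt_pos {E : Finset OmegaOne} {x y : OmegaOne} (hx : x ∈ E) (h : x < y) :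
    pos E x < pos E y := by
  refine Finset.card_lt_card ⟨fun z hz => ?_, fun hs => ?_⟩
  · simp only [Finset.mem_filter] at hz ⊢
    exact ⟨hz.1, hz.2.trans h⟩
  · have := hs (Finset.mem_filter.2 ⟨hx, h⟩)
    simp at this

theorem pos_inj {E : Finset OmegaOne} {x y : OmegaOne} (hx : x ∈ E) (hy : y ∈ E)
    (h : pos E x = pos E y) : x = y := by
  rcases lt_trichotomy x y with hl | he | hl
  · exact absurd h (pos_lt_pos hx hl).ne
  · exact he
  · exact absurd h (pos_lt_pos hy hl).ne'

theorem pos_lt_card {E : Finset OmegaOne} {x : OmegaOne} (hx : x ∈ E) : pos E x < E.card :=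
  Finset.card_lt_card ⟨Finset.filter_subset _ _, fun hs => by
    have := hs hx
    simp at this⟩

theorem exists_pos_eq {E : Finset OmegaOne} {q : ℕ} (hq : q < E.card) : ∃ x ∈ E, pos E x = q := by
  obtain ⟨x, hx, h⟩ := Finset.surj_on_of_inj_on_of_card_le (s := E) (t := Finset.range E.card)
    (fun x _ => pos E x) (fun x hx => Finset.mem_range.2 (pos_lt_card hx))
    (fun x y hx hy h => pos_inj hx hy h) (by simp) q (Finset.mem_range.2 hq)
  exact ⟨x, hx, h.symm⟩

theorem lt_of_pos_lt {E : Finset OmegaOne} {x y : OmegaOne} (h : pos E x < pos E y) : x < y := by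
  by_contra! hl
  exact absurd (pos_mono E hl) (not_le.2 h)

theorem pos_eq_of_initSeg {E E' : Finset OmegaOne} {x : OmegaOne}
    (h : ∀ y < x, y ∈ E ↔ y ∈ E') : pos E x = pos E' x := by
  unfold pos
  congr 1
  ext y
  simp only [Finset.mem_filter]
  exact and_congr_left (h y)

theorem pos_orderEmbOfFin {E : Finset OmegaOne} {m : ℕ} (hm : E.card = m) (a : Fin m) :
    pos E (E.orderEmbOfFin hm a) = a := by
  have : E.filter (· < E.orderEmbOfFin hm a) =
      (Finset.univ.filter (· < a)).map (E.orderEmbOfFin hm).toEmbedding := by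
    ext y
    simp only [Finset.mem_filter, Finset.mem_map, Finset.mem_univ, true_and]
    constructor
    · rintro ⟨hy, h⟩
      have : y ∈ Set.range (E.orderEmbOfFin hm) := by
        rw [Finset.range_orderEmbOfFin]; exact hy
      obtain ⟨b, rfl⟩ := this
      exact ⟨b, by simpa using h, rfl⟩
    · rintro ⟨b, hb, rfl⟩
      exact ⟨Finset.orderEmbOfFin_mem _ _ _, by simpa using hb⟩
  rw [pos, this, Finset.card_map, Finset.filter_gt_eq_Iio, Fin.card_Iio]

theorem orderEmbOfFin_mem_iff {D R : Finset OmegaOne} (hR : R ⊆ D) (hb : Below R (D \ R)) {m : ℕ}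
    (hm : D.card = m) (a : Fin m) : D.orderEmbOfFin hm a ∈ R ↔ (a : ℕ) < R.card := by
  set x := D.orderEmbOfFin hm a with hx
  have hxD : x ∈ D := Finset.orderEmbOfFin_mem _ _ _
  rw [← pos_orderEmbOfFin hm a, ← hx]
  constructor
  · intro h
    rw [pos_eq_of_initSeg (E' := R)]
    · exact pos_lt_card h
    · intro y hy
      refine ⟨fun hyD => ?_, fun h => hR h⟩
      by_contra hyR
      exact absurd (hb x h y (Finset.mem_sdiff.2 ⟨hyD, hyR⟩)) hy.not_gt
  · intro h
    by_contra hxR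
    refine absurd (Finset.card_le_card (s := R) (t := D.filter (· < x)) fun y hy => ?_) (not_le.2 h)
    exact Finset.mem_filter.2 ⟨hR hy, hb y hy x (Finset.mem_sdiff.2 ⟨hxD, hxR⟩)⟩

/-! ### Levels of a construction scheme -/

theorem GoodType.strictMono_m (τ : GoodType) : StrictMono τ.m := by
  refine strictMono_nat_of_lt_succ fun k => ?_
  have h1 := τ.r_lt_m k
  have h2 := Nat.mul_le_mul_left (τ.m k - τ.r (k + 1)) (τ.two_le_n k)
  have h3 := τ.m_succ k
  omega

theorem GoodType.lt_m (τ : GoodType) (k : ℕ) : k < τ.m k := by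
  induction k with
  | zero => simp [τ.m_zero]
  | succ k ih => exact Nat.lt_of_le_of_lt ih (τ.strictMono_m k.lt_succ_self)

variable {τ : GoodType} {F : Set (Finset OmegaOne)}

/-! ### Positions of points in a decomposed set -/

theorem IsDecomposition.mem_iff {k : ℕ} {A R : Finset OmegaOne}
    {part : Fin (τ.n (k + 1)) → Finset OmegaOne} (h : IsDecomposition τ F k A part R)
    {x : OmegaOne} : x ∈ A ↔ ∃ i, x ∈ part i := by
  rw [h.union]; simp

theorem IsDecomposition.root_subset {k : ℕ} {A R : Finset OmegaOne}
    {part : Fin (τ.n (k + 1)) → Finset OmegaOne} (h : IsDecomposition τ F k A part R)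
    (i : Fin (τ.n (k + 1))) : R ⊆ part i := by
  have : Nontrivial (Fin (τ.n (k + 1))) := Fin.nontrivial_iff_two_le.2 (τ.two_le_n k)
  obtain ⟨j, hj⟩ := exists_ne i
  rw [← h.inter i j hj.symm]
  exact Finset.inter_subset_left

theorem IsDecomposition.mem_root {k : ℕ} {A R : Finset OmegaOne}
    {part : Fin (τ.n (k + 1)) → Finset OmegaOne} (h : IsDecomposition τ F k A part R)
    {i j : Fin (τ.n (k + 1))} (hij : i ≠ j) {x : OmegaOne} (hi : x ∈ part i) (hj : x ∈ part j) :
    x ∈ R := by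
  rw [← h.inter i j hij]
  exact Finset.mem_inter.2 ⟨hi, hj⟩

theorem IsDecomposition.pos_root {k : ℕ} {A R : Finset OmegaOne}
    {part : Fin (τ.n (k + 1)) → Finset OmegaOne} (h : IsDecomposition τ F k A part R)
    (i : Fin (τ.n (k + 1))) {x : OmegaOne} (hx : x ∈ R) :
    pos A x = pos (part i) x := by
  refine pos_eq_of_initSeg fun y hy => ⟨fun hyA => ?_, fun hy => h.mem_iff.2 ⟨i, hy⟩⟩
  by_contra hyi
  obtain ⟨j, hj⟩ := h.mem_iff.1 hyA
  refine absurd (h.root_below j x hx y (Finset.mem_sdiff.2 ⟨hj, fun hR => hyi ?_⟩)) hy.not_gt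
  exact h.root_subset i hR

/-- Below a point of the `i`-th tail lie exactly `i` complete tails, each of size `m_k - r_{k+1}`,
and the earlier points of its own part, root included. -/
theorem IsDecomposition.pos_tail {k : ℕ} {A R : Finset OmegaOne}
    {part : Fin (τ.n (k + 1)) → Finset OmegaOne} (h : IsDecomposition τ F k A part R)
    {i : Fin (τ.n (k + 1))} {x : OmegaOne} (hx : x ∈ part i \ R) :
    pos A x = i * (τ.m k - τ.r (k + 1)) + pos (part i) x := by
  have hcard : ∀ j, (part j \ R).card = τ.m k - τ.r (k + 1) := fun j => by
    rw [Finset.card_sdiff_of_subset (h.root_subset j), (h.mem_level j).2, h.card_root]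
  have hunion : A.filter (· < x) =
      ((Finset.univ.filter (· < i)).biUnion fun j => part j \ R) ∪ (part i).filter (· < x) := by
    ext y
    simp only [Finset.mem_filter, Finset.mem_union, Finset.mem_biUnion, Finset.mem_univ, true_and]
    constructor
    · rintro ⟨hyA, hyx⟩
      by_cases hyi : y ∈ part i
      · exact Or.inr ⟨hyi, hyx⟩
      obtain ⟨j, hj⟩ := h.mem_iff.1 hyA
      have hyR : y ∈ part j \ R := Finset.mem_sdiff.2 ⟨hj, fun hR => hyi (h.root_subset i hR)⟩
      refine Or.inl ⟨j, ?_, hyR⟩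
      rcases lt_trichotomy j i with hl | he | hl
      · exact hl
      · exact absurd (he ▸ hj) hyi
      · exact absurd (h.tails_below i j hl x hx y hyR) hyx.not_gt
    · rintro (⟨j, hji, hy⟩ | ⟨hy, hyx⟩)
      · exact ⟨h.mem_iff.2 ⟨j, (Finset.mem_sdiff.1 hy).1⟩, h.tails_below j i hji y hy x hx⟩
      · exact ⟨h.mem_iff.2 ⟨i, hy⟩, hyx⟩
  have hdisj : ∀ j j', j ≠ j' → Disjoint (part j \ R) (part j') := fun j j' hjj =>
    Finset.disjoint_left.2 fun y hy hy' =>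
      (Finset.mem_sdiff.1 hy).2 (h.mem_root hjj (Finset.mem_sdiff.1 hy).1 hy')
  rw [pos, hunion, Finset.card_union_of_disjoint, Finset.card_biUnion]
  · rw [Finset.sum_congr rfl fun j _ => hcard j, Finset.sum_const, Finset.filter_gt_eq_Iio,
      Fin.card_Iio, smul_eq_mul, pos]
  · intro j _ j' _ hjj
    exact (hdisj j j' hjj).mono_right Finset.sdiff_subset
  · rw [Finset.disjoint_biUnion_left]
    intro j hj
    exact (hdisj j i (Finset.mem_filter.1 hj).2.ne).mono_right (Finset.filter_subset _ _)

theorem IsDecomposition.pos_part_lt {k : ℕ} {A R : Finset OmegaOne}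
    {part : Fin (τ.n (k + 1)) → Finset OmegaOne} (h : IsDecomposition τ F k A part R)
    {i : Fin (τ.n (k + 1))} {x : OmegaOne} (hx : x ∈ part i) : pos (part i) x < τ.m k := by
  rw [← (h.mem_level i).2]
  exact pos_lt_card hx

theorem IsDecomposition.mem_root_iff {k : ℕ} {A R : Finset OmegaOne}
    {part : Fin (τ.n (k + 1)) → Finset OmegaOne} (h : IsDecomposition τ F k A part R)
    {i : Fin (τ.n (k + 1))} {x : OmegaOne} (hx : x ∈ part i) :
    x ∈ R ↔ pos (part i) x < τ.r (k + 1) := by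
  constructor
  · intro hR
    rw [pos_eq_of_initSeg (E' := R), ← h.card_root]
    · exact pos_lt_card hR
    · intro y hy
      refine ⟨fun hyi => ?_, fun hyR => h.root_subset i hyR⟩
      by_contra hyR
      exact absurd (h.root_below i x hR y (Finset.mem_sdiff.2 ⟨hyi, hyR⟩)) hy.not_gt
  · intro hlt
    by_contra hR
    rw [← h.card_root] at hlt
    refine absurd (Finset.card_le_card (s := R) (t := (part i).filter (· < x)) fun y hy => ?_)
      (not_le.2 hlt)
    exact Finset.mem_filter.2 ⟨h.root_subset i hy, h.root_below i y hy x
      (Finset.mem_sdiff.2 ⟨hx, hR⟩)⟩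

/-- The position of a point in `A` determines the tail of a decomposition it lies in. -/
theorem IsDecomposition.tail_unique {k : ℕ} {A A' R R' : Finset OmegaOne}
    {part part' : Fin (τ.n (k + 1)) → Finset OmegaOne} (h : IsDecomposition τ F k A part R)
    (h' : IsDecomposition τ F k A' part' R') {i i' : Fin (τ.n (k + 1))} {x x' : OmegaOne}
    (hx : x ∈ part i \ R) (hx' : x' ∈ part' i' \ R') (hp : pos A x = pos A' x') :
    i = i' ∧ pos (part i) x = pos (part' i') x' := by
  rw [h.pos_tail hx, h'.pos_tail hx'] at hp
  obtain ⟨hxi, hxR⟩ := Finset.mem_sdiff.1 hx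
  obtain ⟨hxi', hxR'⟩ := Finset.mem_sdiff.1 hx'
  have h1 := h.pos_part_lt hxi
  have h1' := h'.pos_part_lt hxi'
  rw [h.mem_root_iff hxi, not_lt] at hxR
  rw [h'.mem_root_iff hxi', not_lt] at hxR'
  -- Positions of tail points inside a part lie in `[r_{k+1}, m_k)`, an interval of the length of
  -- one tail, so the tail index is a quotient and the rest a remainder.
  have hi : (i : ℕ) = i' := by
    rcases lt_trichotomy (i : ℕ) i' with hl | he | hl
    · have := Nat.mul_le_mul_right (τ.m k - τ.r (k + 1)) (Nat.succ_le_of_lt hl)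
      rw [Nat.succ_mul] at this
      omega
    · exact he
    · have := Nat.mul_le_mul_right (τ.m k - τ.r (k + 1)) (Nat.succ_le_of_lt hl)
      rw [Nat.succ_mul] at this
      omega
  obtain rfl : i = i' := Fin.ext hi
  exact ⟨rfl, by omega⟩

/-- The position of a point in `A` determines whether it lies in the root. -/
theorem IsDecomposition.root_of_pos {k : ℕ} {A A' R R' : Finset OmegaOne}
    {part part' : Fin (τ.n (k + 1)) → Finset OmegaOne} (h : IsDecomposition τ F k A part R)
    (h' : IsDecomposition τ F k A' part' R') {x x' : OmegaOne}
    (hx : x ∈ R) (hx' : x' ∈ A') (hp : pos A x = pos A' x') : x' ∈ R' := by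
  obtain ⟨i, hi⟩ := h'.mem_iff.1 hx'
  by_contra hR
  have h1 := h'.pos_tail (Finset.mem_sdiff.2 ⟨hi, hR⟩)
  have h2 := h.pos_root i hx
  have h3 := (h.mem_root_iff (h.root_subset i hx)).1 hx
  rw [h'.mem_root_iff hi, not_lt] at hR
  omega

namespace IsConstructionScheme

variable (hF : IsConstructionScheme τ F)
include hF

/-! ### Coherence between levels -/

theorem exists_level_subset {k j : ℕ} (hkj : k ≤ j) {A : Finset OmegaOne} (hA : A ∈ level τ F j)
    {x : OmegaOne} (hx : x ∈ A) : ∃ B ∈ level τ F k, x ∈ B ∧ B ⊆ A := by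
  induction j, hkj using Nat.le_induction generalizing A with
  | base => exact ⟨A, hA, hx, subset_rfl⟩
  | succ j _ ih =>
    obtain ⟨part, R, h⟩ := hF.decomposition j A hA
    obtain ⟨i, hi⟩ := h.mem_iff.1 hx
    obtain ⟨B, hB, hxB, hBi⟩ := ih (h.mem_level i) hi
    exact ⟨B, hB, hxB, hBi.trans fun y hy => h.mem_iff.2 ⟨i, hy⟩⟩

theorem mem_of_le {k : ℕ} {A B : Finset OmegaOne} (hA : A ∈ level τ F k) (hB : B ∈ level τ F k)
    {x y : OmegaOne} (hxA : x ∈ A) (hxB : x ∈ B) (hy : y ∈ A) (hyx : y ≤ x) : y ∈ B := by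
  rcases hyx.eq_or_lt with rfl | hyx
  · exact hxB
  · exact (Finset.mem_inter.1 ((hF.inter_initSeg k A hA B hB).1.2 x
      (Finset.mem_inter.2 ⟨hxA, hxB⟩) y hy hyx)).2

theorem mem_of_le_of_le {k j : ℕ} (hkj : k ≤ j) {A B : Finset OmegaOne} (hA : A ∈ level τ F k)
    (hB : B ∈ level τ F j) {x y : OmegaOne} (hxA : x ∈ A) (hxB : x ∈ B) (hy : y ∈ A)
    (hyx : y ≤ x) : y ∈ B := by
  obtain ⟨B', hB', hxB', hsub⟩ := hF.exists_level_subset hkj hB hxB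
  exact hsub (hF.mem_of_le hA hB' hxA hxB' hy hyx)

theorem exists_level_superset (k : ℕ) (A : Finset OmegaOne) :
    ∃ j ≥ k, ∃ B ∈ level τ F j, A ⊆ B := by
  have : Infinite OmegaOne := by
    rw [Cardinal.infinite_iff, mk_omegaOne]
    exact Cardinal.aleph0_lt_aleph_one.le
  -- Padding by `m_k` further points forces the covering member to have level at least `k`.
  obtain ⟨C, hC⟩ := Infinite.exists_subset_card_eq OmegaOne (τ.m k)
  obtain ⟨B, hB, hsub⟩ := hF.cofinal (A ∪ C) (by
    refine Finset.Nonempty.inr (Finset.card_pos.1 ?_)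
    rw [hC]
    exact (Nat.zero_le _).trans_lt (τ.lt_m k))
  obtain ⟨j, hj⟩ := hF.card_mem B hB
  refine ⟨j, ?_, B, ⟨hB, hj⟩, Finset.union_subset_left hsub⟩
  have := Finset.card_le_card (Finset.union_subset_right hsub)
  rw [hC, hj] at this
  exact τ.strictMono_m.le_iff_le.1 this

theorem exists_mem_level (k : ℕ) (x : OmegaOne) : ∃ A ∈ level τ F k, x ∈ A := by
  obtain ⟨j, hj, B, hB, hx⟩ := hF.exists_level_superset k {x}
  obtain ⟨A, hA, hxA, -⟩ := hF.exists_level_subset hj hB (Finset.singleton_subset_iff.1 hx)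
  exact ⟨A, hA, hxA⟩

/-- It is enough to cover the maximum: coherence then pulls in every smaller point. -/
theorem exists_level_superset_of_le {k j : ℕ} (hkj : k ≤ j) {A : Finset OmegaOne}
    (hA : A ∈ level τ F k) : ∃ B ∈ level τ F j, A ⊆ B := by
  have hne := hF.nonempty A hA.1
  obtain ⟨B, hB, hx⟩ := hF.exists_mem_level j (A.max' hne)
  exact ⟨B, hB, fun y hy => hF.mem_of_le_of_le hkj hA hB (A.max'_mem hne) hx hy (A.le_max' y hy)⟩

theorem rho_le_iff {k : ℕ} {x y : OmegaOne} :
    rho τ F x y ≤ k ↔ ∃ A ∈ level τ F k, x ∈ A ∧ y ∈ A := by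
  constructor
  · intro h
    have hne : {k | ∃ A ∈ level τ F k, x ∈ A ∧ y ∈ A}.Nonempty := by
      obtain ⟨j, -, B, hB, hsub⟩ := hF.exists_level_superset 0 {x, y}
      exact ⟨j, B, hB, hsub (by simp), hsub (by simp)⟩
    obtain ⟨A, hA, hx, hy⟩ := Nat.sInf_mem hne
    obtain ⟨B, hB, hsub⟩ := hF.exists_level_superset_of_le h hA
    exact ⟨B, hB, hsub hx, hsub hy⟩
  · exact fun h => Nat.sInf_le h

omit hF in
theorem _root_.Scheme.rho_comm (x y : OmegaOne) : rho τ F x y = rho τ F y x := by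
  unfold rho
  congr 1
  ext k
  simp only [Set.mem_ofPred_eq]
  exact exists_congr fun A => and_congr_right fun _ => and_comm

/-- The `k`-closure of `x` is contained in every member of level at least `k` that contains `x`;
this replaces any choice of a member by the intrinsic `rho`. -/
theorem mem_of_rho_le {k j : ℕ} (hkj : k ≤ j) {x y : OmegaOne} (h : rho τ F x y ≤ k) (hyx : y ≤ x)
    {A : Finset OmegaOne} (hA : A ∈ level τ F j) (hx : x ∈ A) : y ∈ A := by
  obtain ⟨B, hB, hxB, hyB⟩ := hF.rho_le_iff.1 h
  exact hF.mem_of_le_of_le hkj hB hA hxB hx hyB hyx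

theorem cardFun_eq_pos {k : ℕ} {A : Finset OmegaOne} (hA : A ∈ level τ F k) {x : OmegaOne}
    (hx : x ∈ A) : cardFun τ F x k = pos A x := by
  rw [cardFun, pos, ← Set.ncard_coe_finset]
  congr 1
  ext y
  simp only [Set.mem_ofPred_eq, Finset.coe_filter]
  constructor
  · rintro ⟨hyx, h⟩
    exact ⟨hF.mem_of_rho_le le_rfl h hyx.le hA hx, hyx⟩
  · rintro ⟨hy, hyx⟩
    exact ⟨hyx, hF.rho_le_iff.2 ⟨A, hA, hx, hy⟩⟩

theorem rho_self (x : OmegaOne) : rho τ F x x = 0 := by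
  obtain ⟨A, hA, hx⟩ := hF.exists_mem_level 0 x
  exact Nat.le_zero.1 (hF.rho_le_iff.2 ⟨A, hA, hx, hx⟩)

/-- Points of different tails are first joined at the level of the decomposition. -/
theorem rho_eq_of_tails {k : ℕ} {A R : Finset OmegaOne} {part : Fin (τ.n (k + 1)) → Finset OmegaOne}
    (hA : A ∈ level τ F (k + 1)) (h : IsDecomposition τ F k A part R) {i j : Fin (τ.n (k + 1))}
    (hij : i ≠ j) {x y : OmegaOne} (hx : x ∈ part i \ R) (hy : y ∈ part j \ R) :
    rho τ F x y = k + 1 := by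
  wlog hlt : i < j generalizing i j x y
  · rw [rho_comm]
    exact this hij.symm hy hx (lt_of_le_of_ne (not_lt.1 hlt) hij.symm)
  obtain ⟨hxi, hxR⟩ := Finset.mem_sdiff.1 hx
  obtain ⟨hyj, hyR⟩ := Finset.mem_sdiff.1 hy
  refine le_antisymm (hF.rho_le_iff.2 ⟨A, hA, h.mem_iff.2 ⟨i, hxi⟩, h.mem_iff.2 ⟨j, hyj⟩⟩) ?_
  by_contra! hle
  rw [rho_comm] at hle
  have hxj := hF.mem_of_rho_le le_rfl (Nat.lt_succ_iff.1 hle)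
    (h.tails_below i j hlt x hx y hy).le (h.mem_level j) hyj
  exact hxR (h.mem_root hij hxi hxj)

/-! ### Isomorphism of the members of a level -/

/-- Positions determine root and tail indices, so the order isomorphism respects the decompositions.
Two points in a common part are treated by induction; two points in no common part lie in different
tails, where `rho` is `k + 1` on both sides. -/
theorem rho_eq_of_pos_eq {k : ℕ} {E E' : Finset OmegaOne} (hE : E ∈ level τ F k)
    (hE' : E' ∈ level τ F k) {x y x' y' : OmegaOne} (hx : x ∈ E) (hy : y ∈ E) (hx' : x' ∈ E')
    (hy' : y' ∈ E') (hxx : pos E x = pos E' x') (hyy : pos E y = pos E' y') :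
    rho τ F x y = rho τ F x' y' := by
  induction k generalizing E E' with
  | zero =>
    have h1 : ∀ A ∈ level τ F 0, ∀ u ∈ A, ∀ v ∈ A, u = v := fun A hA =>
      fun u hu v hv => Finset.card_le_one.1 (hA.2.trans τ.m_zero).le u hu v hv
    rw [h1 E hE x hx y hy, h1 E' hE' x' hx' y' hy', hF.rho_self, hF.rho_self]
  | succ k ih =>
    obtain ⟨part, R, h⟩ := hF.decomposition k E hE
    obtain ⟨part', R', h'⟩ := hF.decomposition k E' hE'
    have key : ∀ {z z' : OmegaOne} {i : Fin (τ.n (k + 1))}, z ∈ part i → z' ∈ E' →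
        pos E z = pos E' z' → z' ∈ part' i ∧ pos (part i) z = pos (part' i) z' ∧
          (z ∈ R ↔ z' ∈ R') := by
      intro z z' i hz hz' hp
      by_cases hR : z ∈ R
      · have hR' := h.root_of_pos h' hR hz' hp
        refine ⟨h'.root_subset i hR', ?_, by simp [hR, hR']⟩
        rw [← h.pos_root i hR, ← h'.pos_root i hR', hp]
      · have hR' : z' ∉ R' := fun hR' =>
          hR (h'.root_of_pos h hR' (h.mem_iff.2 ⟨i, hz⟩) hp.symm)
        obtain ⟨j, hj⟩ := h'.mem_iff.1 hz'
        obtain ⟨rfl, hpos⟩ := h.tail_unique h' (Finset.mem_sdiff.2 ⟨hz, hR⟩)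
          (Finset.mem_sdiff.2 ⟨hj, hR'⟩) hp
        exact ⟨hj, hpos, by simp [hR, hR']⟩
    by_cases hc : ∃ i, x ∈ part i ∧ y ∈ part i
    · obtain ⟨i, hxi, hyi⟩ := hc
      obtain ⟨hxi', hpx, -⟩ := key hxi hx' hxx
      obtain ⟨hyi', hpy, -⟩ := key hyi hy' hyy
      exact ih (h.mem_level i) (h'.mem_level i) hxi hyi hxi' hyi' hpx hpy
    · obtain ⟨i, hi⟩ := h.mem_iff.1 hx
      obtain ⟨j, hj⟩ := h.mem_iff.1 hy
      have hij : i ≠ j := by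
        rintro rfl
        exact hc ⟨i, hi, hj⟩
      have hxR : x ∉ R := fun hR => hc ⟨j, h.root_subset j hR, hj⟩
      have hyR : y ∉ R := fun hR => hc ⟨i, hi, h.root_subset i hR⟩
      obtain ⟨hxi', -, hRx⟩ := key hi hx' hxx
      obtain ⟨hyj', -, hRy⟩ := key hj hy' hyy
      rw [hF.rho_eq_of_tails hE h hij (Finset.mem_sdiff.2 ⟨hi, hxR⟩) (Finset.mem_sdiff.2 ⟨hj, hyR⟩),
        hF.rho_eq_of_tails hE' h' hij (Finset.mem_sdiff.2 ⟨hxi', by tauto⟩)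
          (Finset.mem_sdiff.2 ⟨hyj', by tauto⟩)]

/-- The value of `‖x‖_k` determines the values `‖x‖_j` for `j ≤ k`. -/
theorem cardFun_eq_of_le {k j : ℕ} (hjk : j ≤ k) {x x' : OmegaOne}
    (h : cardFun τ F x k = cardFun τ F x' k) : cardFun τ F x j = cardFun τ F x' j := by
  have key : ∀ {x x' : OmegaOne}, cardFun τ F x k = cardFun τ F x' k →
      cardFun τ F x j ≤ cardFun τ F x' j := by
    intro x x' h
    obtain ⟨E, hE, hx⟩ := hF.exists_mem_level k x
    obtain ⟨E', hE', hx'⟩ := hF.exists_mem_level k x'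
    rw [hF.cardFun_eq_pos hE hx, hF.cardFun_eq_pos hE' hx'] at h
    obtain ⟨B, hB, hxB, hBE⟩ := hF.exists_level_subset hjk hE hx
    obtain ⟨B', hB', hxB', hBE'⟩ := hF.exists_level_subset hjk hE' hx'
    rw [hF.cardFun_eq_pos hB hxB, hF.cardFun_eq_pos hB' hxB']
    have hex : ∀ y ∈ E, ∃ y' ∈ E', pos E y = pos E' y' := fun y hy => by
      obtain ⟨y', hy', he⟩ := exists_pos_eq (E := E') (q := pos E y) (by
        rw [hE'.2, ← hE.2]; exact pos_lt_card hy)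
      exact ⟨y', hy', he.symm⟩
    have : Nonempty OmegaOne := ⟨x⟩
    choose! f hf hfp using hex
    -- The isomorphism `E → E'` takes `x` to `x'` and preserves `rho`, so it embeds the `j`-closure
    -- of `x` in that of `x'`.
    refine Finset.card_le_card_of_injOn f ?_ ?_
    · intro y hy
      obtain ⟨hyB, hyx⟩ := Finset.mem_filter.1 (Finset.mem_coe.1 hy)
      have hyE := hBE hyB
      have hlt : f y < x' := lt_of_pos_lt (E := E') (by
        rw [← hfp y hyE, ← h]; exact pos_lt_pos hyE hyx)
      have hr := hF.rho_eq_of_pos_eq hE hE' hx hyE hx' (hf y hyE) h (hfp y hyE)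
      have hr' : rho τ F x' (f y) ≤ j := hr ▸ hF.rho_le_iff.2 ⟨B, hB, hxB, hyB⟩
      exact Finset.mem_coe.2 (Finset.mem_filter.2
        ⟨hF.mem_of_rho_le le_rfl hr' hlt.le hB' hxB', hlt⟩)
    · intro y hy z hz hyz
      have hyE := hBE (Finset.mem_filter.1 (Finset.mem_coe.1 hy)).1
      have hzE := hBE (Finset.mem_filter.1 (Finset.mem_coe.1 hz)).1
      exact pos_inj hyE hzE (by rw [hfp y hyE, hfp z hzE, hyz])
  exact le_antisymm (key h) (key h.symm)

theorem eq_of_cardFun_eq {k : ℕ} {A : Finset OmegaOne} (hA : A ∈ level τ F k) {x y : OmegaOne}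
    (hx : x ∈ A) (hy : y ∈ A) (h : cardFun τ F x k = cardFun τ F y k) : x = y := by
  rw [hF.cardFun_eq_pos hA hx, hF.cardFun_eq_pos hA hy] at h
  exact pos_inj hx hy h

/-- If `α` and `α'` have the same position at level `l`, then points of their `k`-closures with
the same position at level `k` have the same position at level `l`. -/
theorem cardFun_eq_of_closure {k l : ℕ} (hkl : k ≤ l) {α α' x x' : OmegaOne}
    (hα : cardFun τ F α l = cardFun τ F α' l) (hx : rho τ F α x ≤ k) (hxα : x ≤ α)
    (hx' : rho τ F α' x' ≤ k) (hxα' : x' ≤ α') (hxx : cardFun τ F x k = cardFun τ F x' k) :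
    cardFun τ F x l = cardFun τ F x' l := by
  obtain ⟨E, hE, hαE⟩ := hF.exists_mem_level l α
  obtain ⟨E', hE', hαE'⟩ := hF.exists_mem_level l α'
  have hxE := hF.mem_of_rho_le hkl hx hxα hE hαE
  obtain ⟨y, hy, hpy⟩ := exists_pos_eq (E := E') (q := pos E x) (by
    rw [hE'.2, ← hE.2]; exact pos_lt_card hxE)
  rw [hF.cardFun_eq_pos hE hαE, hF.cardFun_eq_pos hE' hαE'] at hα
  have hr := hF.rho_eq_of_pos_eq hE hE' hαE hxE hαE' hy hα hpy.symm
  have hyα : y ≤ α' := by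
    by_contra! hlt
    have := pos_lt_pos hαE' hlt
    have := pos_mono E hxα
    omega
  have hxy : cardFun τ F x l = cardFun τ F y l := by
    rw [hF.cardFun_eq_pos hE hxE, hF.cardFun_eq_pos hE' hy, hpy]
  obtain ⟨B, hB, hαB⟩ := hF.exists_mem_level k α'
  have hyB := hF.mem_of_rho_le le_rfl (hr ▸ hx) hyα hB hαB
  have hxB := hF.mem_of_rho_le le_rfl hx' hxα' hB hαB
  -- The copy `y` of `x` in `E'` and the point `x'` both lie in the `k`-closure of `α'`, at the same
  -- position.
  have : y = x' := hF.eq_of_cardFun_eq hB hyB hxB (by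
    rw [← hxx]; exact (hF.cardFun_eq_of_le hkl hxy).symm)
  rw [hxy, this]

/-! ### The functions `Ξ` and `Δ` -/

theorem Xi_root {k : ℕ} {A R : Finset OmegaOne} {part : Fin (τ.n (k + 1)) → Finset OmegaOne}
    (hA : A ∈ level τ F (k + 1)) (h : IsDecomposition τ F k A part R) {x : OmegaOne} (hx : x ∈ R) :
    Xi τ F x (k + 1) = -1 := by
  have hxA : x ∈ A :=
    h.mem_iff.2 ⟨⟨0, zero_lt_two.trans_le (τ.two_le_n k)⟩, h.root_subset _ hx⟩
  have hex : ∃ v, XiGraph τ F x (k + 1) v := ⟨-1, A, hA, hxA, part, R, h, Or.inl ⟨hx, rfl⟩⟩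
  rw [Xi, dif_pos hex]
  -- The value chosen in `Xi` may come from another set `A'`, but the position of `x` is `‖x‖_{k+1}`
  -- in both sets and decides between root and tails.
  obtain ⟨A', hA', hxA', part', R', h', hv⟩ := hex.choose_spec
  have hp : pos A x = pos A' x := by
    rw [← hF.cardFun_eq_pos hA hxA, ← hF.cardFun_eq_pos hA' hxA']
  rcases hv with ⟨-, hv⟩ | ⟨i, hi, -⟩
  · exact hv
  · exact absurd (h.root_of_pos h' hx hxA' hp) (Finset.mem_sdiff.1 hi).2

theorem Xi_tail {k : ℕ} {A R : Finset OmegaOne} {part : Fin (τ.n (k + 1)) → Finset OmegaOne}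
    (hA : A ∈ level τ F (k + 1)) (h : IsDecomposition τ F k A part R) {x : OmegaOne}
    {i : Fin (τ.n (k + 1))} (hx : x ∈ part i \ R) : Xi τ F x (k + 1) = (i : ℕ) := by
  have hxA : x ∈ A := h.mem_iff.2 ⟨i, (Finset.mem_sdiff.1 hx).1⟩
  have hex : ∃ v, XiGraph τ F x (k + 1) v := ⟨(i : ℕ), A, hA, hxA, part, R, h, Or.inr ⟨i, hx, rfl⟩⟩
  rw [Xi, dif_pos hex]
  obtain ⟨A', hA', hxA', part', R', h', hv⟩ := hex.choose_spec
  have hp : pos A x = pos A' x := by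
    rw [← hF.cardFun_eq_pos hA hxA, ← hF.cardFun_eq_pos hA' hxA']
  rcases hv with ⟨hR', -⟩ | ⟨j, hj, hv⟩
  · exact absurd (h'.root_of_pos h hR' hxA hp.symm) (Finset.mem_sdiff.1 hx).2
  · rw [hv, (h.tail_unique h' hx hj hp).1]

end IsConstructionScheme

theorem Del_eq_iff {x y : OmegaOne} {l : ℕ} : Del τ F x y = (l : ℕ∞) ↔
    cardFun τ F x l ≠ cardFun τ F y l ∧ ∀ j < l, cardFun τ F x j = cardFun τ F y j := by
  constructor
  · intro h
    have hlt : ∀ j < l, cardFun τ F x j = cardFun τ F y j := by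
      intro j hj
      by_contra hne
      have : Del τ F x y ≤ (j : ℕ∞) := iInf₂_le j hne
      rw [h] at this
      exact absurd (Nat.cast_le.1 this) (not_le.2 hj)
    refine ⟨fun he => ?_, hlt⟩
    have : ((l + 1 : ℕ) : ℕ∞) ≤ Del τ F x y := by
      refine le_iInf₂ fun j hj => Nat.cast_le.2 ?_
      by_contra! hjl
      rcases (Nat.lt_succ_iff.1 hjl).eq_or_lt with rfl | hlt'
      · exact hj he
      · exact hj (hlt j hlt')
    rw [h] at this
    exact absurd (Nat.cast_le.1 this) (by omega)
  · rintro ⟨hne, hlt⟩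
    refine le_antisymm (iInf₂_le l hne) (le_iInf₂ fun j hj => Nat.cast_le.2 ?_)
    by_contra! hjl
    exact hj (hlt j hjl)

/-! ### Captured points and the sets carried along by them -/

theorem captured_singletons {n l : ℕ} {α : Fin n → OmegaOne}
    (h : Captured τ F (fun i => {α i}) l) :
    Function.Injective α ∧ (∀ i, Xi τ F (α i) l = ((i : ℕ) : ℤ)) ∧
      ∀ i j, i < j → rho τ F (α i) (α j) = l ∧ Del τ F (α i) (α j) = (l : ℕ∞) := by
  obtain ⟨m, hm, R, hm1, hR, hXi, hrho⟩ := h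
  have hinj : Function.Injective α := fun i j hij => hR.injective (by simp [hij])
  have h2 := hR.two_le
  have hR0 : R = ∅ := by
    have hne : (⟨0, by omega⟩ : Fin n) ≠ ⟨1, by omega⟩ := by simp
    rw [← hR.inter _ _ hne, Finset.singleton_inter_of_notMem]
    exact fun hmem => hne (hinj (Finset.mem_singleton.1 hmem))
  subst hR0
  have hval : ∀ i a, ({α i} : Finset OmegaOne).orderEmbOfFin (hm i) a = α i := fun i a =>
    Finset.mem_singleton.1 (Finset.orderEmbOfFin_mem _ (hm i) a)
  refine ⟨hinj, fun i => ?_, fun i j hij => ?_⟩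
  · have := hXi i ⟨0, hm1⟩
    rw [hval] at this
    simpa using this
  · have := hrho i j hij ⟨0, hm1⟩ (by simp)
    rwa [hval, hval] at this

/-- The points `α_i` lie at the same position of consecutive tails of a decomposition of `A`. -/
structure IsSpread (τ : GoodType) (F : Set (Finset OmegaOne)) {n : ℕ} (k : ℕ)
    (α : Fin n → OmegaOne) (A : Finset OmegaOne) (part : Fin (τ.n (k + 1)) → Finset OmegaOne)
    (R : Finset OmegaOne) (e : Fin n → Fin (τ.n (k + 1))) : Prop where
  mem_level : A ∈ level τ F (k + 1)
  decomposition : IsDecomposition τ F k A part R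
  val_eq : ∀ i, (e i : ℕ) = i
  mem_tail : ∀ i, α i ∈ part (e i) \ R
  cardFun_eq : ∀ i j, cardFun τ F (α i) k = cardFun τ F (α j) k

namespace IsConstructionScheme

variable (hF : IsConstructionScheme τ F)
include hF

/-- A member of level `l` containing the largest point contains them all; `Xi` then names the tail
of each point, and `Del` being `l` makes the positions agree one level lower. Level `0` is excluded
because its members are singletons. -/
theorem exists_isSpread {n l : ℕ} (hn : 2 ≤ n) {α : Fin n → OmegaOne}
    (h : Captured τ F (fun i => {α i}) l) :
    ∃ k A part R e, l = k + 1 ∧ IsSpread τ F k α A part R e := by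
  obtain ⟨hinj, hXi, hrho⟩ := captured_singletons h
  have hrho' : ∀ i j, rho τ F (α i) (α j) ≤ l := fun i j => by
    rcases lt_trichotomy i j with hij | rfl | hij
    · exact (hrho i j hij).1.le
    · rw [hF.rho_self]; exact Nat.zero_le _
    · rw [rho_comm]; exact (hrho j i hij).1.le
  have : Nonempty (Fin n) := ⟨⟨0, by omega⟩⟩
  obtain ⟨M, hM⟩ := Finite.exists_max α
  obtain ⟨A, hA, hMA⟩ := hF.exists_mem_level l (α M)
  have hαA : ∀ i, α i ∈ A := fun i => hF.mem_of_rho_le le_rfl (hrho' M i) (hM i) hA hMA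
  obtain _ | k := l
  · have hne : (⟨0, by omega⟩ : Fin n) ≠ ⟨1, by omega⟩ := by simp
    exact absurd (hinj (Finset.card_le_one.1 (hA.2.trans τ.m_zero).le _ (hαA _) _ (hαA _))) hne
  obtain ⟨part, R, hd⟩ := hF.decomposition k A hA
  have hex : ∀ i : Fin n, ∃ j : Fin (τ.n (k + 1)), (j : ℕ) = i ∧ α i ∈ part j \ R := fun i => by
    obtain ⟨j, hj⟩ := hd.mem_iff.1 (hαA i)
    have hR : α i ∉ R := fun hR => by
      have h1 := hXi i
      rw [hF.Xi_root hA hd hR] at h1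
      omega
    have hj' := Finset.mem_sdiff.2 ⟨hj, hR⟩
    refine ⟨j, ?_, hj'⟩
    have h1 := hXi i
    rw [hF.Xi_tail hA hd hj'] at h1
    exact_mod_cast h1
  choose e he hmem using hex
  refine ⟨k, A, part, R, e, rfl, hA, hd, he, hmem, fun i j => ?_⟩
  rcases lt_trichotomy i j with hij | rfl | hij
  · exact (Del_eq_iff.1 (hrho i j hij).2).2 k k.lt_succ_self
  · rfl
  · exact ((Del_eq_iff.1 (hrho j i hij).2).2 k k.lt_succ_self).symm

/-- `D` lies in the closure at level `j` of the point `α`. -/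
def _root_.Scheme.InClosure (τ : GoodType) (F : Set (Finset OmegaOne)) (j : ℕ) (α : OmegaOne)
    (D : Finset OmegaOne) : Prop := ∀ x ∈ D, x ≤ α ∧ rho τ F α x ≤ j

omit hF in
theorem _root_.Scheme.InClosure.mono {j : ℕ} {α : OmegaOne} {D D' : Finset OmegaOne}
    (h : InClosure τ F j α D') (hs : D ⊆ D') : InClosure τ F j α D := fun x hx => h x (hs hx)

theorem mem_part_of_inClosure {n k j : ℕ} (hjk : j ≤ k) {α : Fin n → OmegaOne}
    {A : Finset OmegaOne} {part : Fin (τ.n (k + 1)) → Finset OmegaOne} {R : Finset OmegaOne}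
    {e : Fin n → Fin (τ.n (k + 1))} (hs : IsSpread τ F k α A part R e) {i : Fin n}
    {D : Finset OmegaOne} (hD : InClosure τ F j (α i) D) : D ⊆ part (e i) := fun x hx =>
  hF.mem_of_rho_le hjk (hD x hx).2 (hD x hx).1 (hs.decomposition.mem_level _)
    (Finset.mem_sdiff.1 (hs.mem_tail i)).1

/-- Equal positions in the closures persist at level `k`, and a root point also belongs to the part
containing `x'`; inside one part positions are injective. -/
theorem root_inter_subset {n k j : ℕ} (hjk : j ≤ k) {α : Fin n → OmegaOne}
    {A : Finset OmegaOne} {part : Fin (τ.n (k + 1)) → Finset OmegaOne} {R : Finset OmegaOne}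
    {e : Fin n → Fin (τ.n (k + 1))} (hs : IsSpread τ F k α A part R e)
    {i i' : Fin n} {D D' : Finset OmegaOne} (hD : InClosure τ F j (α i) D)
    (hD' : InClosure τ F j (α i') D')
    {x x' : OmegaOne} (hx : x ∈ D) (hx' : x' ∈ D') (hxR : x ∈ R)
    (h : cardFun τ F x j = cardFun τ F x' j) : x = x' := by
  have hk := hF.cardFun_eq_of_closure hjk (hs.cardFun_eq i i') (hD x hx).2 (hD x hx).1
    (hD' x' hx').2 (hD' x' hx').1 h
  exact hF.eq_of_cardFun_eq (hs.decomposition.mem_level (e i')) (hs.decomposition.root_subset _ hxR)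
    (hF.mem_part_of_inClosure hjk hs hD' hx') hk

/-- If points `α_i` are captured, then so are sets which occupy the same positions of the closures
of the points `α_i` at some lower level. -/
theorem captured_of_isSpread {n k j : ℕ} (hn : 2 ≤ n) (hjk : j ≤ k) {α : Fin n → OmegaOne}
    {A : Finset OmegaOne} {part : Fin (τ.n (k + 1)) → Finset OmegaOne} {R : Finset OmegaOne}
    {e : Fin n → Fin (τ.n (k + 1))} (hs : IsSpread τ F k α A part R e)
    {D : Fin n → Finset OmegaOne} (hD : ∀ i, InClosure τ F j (α i) (D i)) {Q : Finset ℕ}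
    (hQ : ∀ i, (D i).image (fun x => cardFun τ F x j) = Q) (hinj : Function.Injective D)
    (hne : ∀ i, (D i).Nonempty) : Captured τ F D (k + 1) := by
  have hd := hs.decomposition
  have heinj : Function.Injective e := fun i i' h => Fin.ext (by
    rw [← hs.val_eq i, ← hs.val_eq i', h])
  have hpart : ∀ i, D i ⊆ part (e i) := fun i => hF.mem_part_of_inClosure hjk hs (hD i)
  have hmono : ∀ i, StrictMonoOn (fun x => cardFun τ F x j) (D i : Set OmegaOne) := by
    intro i x hx y hy hxy
    obtain ⟨B, hB, hαB⟩ := hF.exists_mem_level j (α i)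
    have hmem : ∀ z ∈ D i, z ∈ B := fun z hz =>
      hF.mem_of_rho_le le_rfl (hD i z hz).2 (hD i z hz).1 hB hαB
    simp only
    rw [hF.cardFun_eq_pos hB (hmem x hx), hF.cardFun_eq_pos hB (hmem y hy)]
    exact pos_lt_pos (hmem x hx) hxy
  have hcard : ∀ i, (D i).card = Q.card := fun i => by
    rw [← hQ i, Finset.card_image_of_injOn (hmono i).injOn]
  -- Since `‖·‖_j` is strictly increasing on `D i`, the `a`-th element of `D i` occupies the `a`-th
  -- position of `Q`.
  have hval : ∀ i a, cardFun τ F ((D i).orderEmbOfFin (hcard i) a) j = Q.orderEmbOfFin rfl a := by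
    intro i a
    refine congrFun (Finset.orderEmbOfFin_unique rfl
      (f := fun a => cardFun τ F ((D i).orderEmbOfFin (hcard i) a) j) (fun b => ?_) ?_) a
    · exact (Finset.ext_iff.1 (hQ i) _).1
        (Finset.mem_image_of_mem _ (Finset.orderEmbOfFin_mem _ _ _))
    · intro b c hbc
      exact hmono i (Finset.orderEmbOfFin_mem _ _ _) (Finset.orderEmbOfFin_mem _ _ _)
        ((D i).orderEmbOfFin (hcard i) |>.strictMono hbc)
  have hsub : ∀ i i', D i ∩ R ⊆ D i' := by
    intro i i' x hx
    obtain ⟨hxD, hxR⟩ := Finset.mem_inter.1 hx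
    have : cardFun τ F x j ∈ (D i').image (fun x => cardFun τ F x j) := by
      rw [hQ i', ← hQ i]
      exact Finset.mem_image_of_mem _ hxD
    obtain ⟨y, hy, hxy⟩ := Finset.mem_image.1 this
    rw [hF.root_inter_subset hjk hs (hD i) (hD i') hxD hy hxR hxy.symm]
    exact hy
  set i₀ : Fin n := ⟨0, by omega⟩
  -- All `D i` have the same trace on the root `R`; this trace is the root of the captured system.
  set R' := D i₀ ∩ R with hR'
  have hDR : ∀ i, D i ∩ R = R' := fun i => Finset.Subset.antisymm
    (Finset.subset_inter (hsub i i₀) Finset.inter_subset_right)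
    (Finset.subset_inter (hsub i₀ i) Finset.inter_subset_right)
  have hR'D : ∀ i, R' ⊆ D i := fun i => hsub i₀ i
  have hR'R : R' ⊆ R := Finset.inter_subset_right
  have htail : ∀ i, D i \ R' ⊆ part (e i) \ R := fun i x hx => by
    obtain ⟨hxD, hxR⟩ := Finset.mem_sdiff.1 hx
    refine Finset.mem_sdiff.2 ⟨hpart i hxD, fun h => hxR ?_⟩
    rw [← hDR i]
    exact Finset.mem_inter.2 ⟨hxD, h⟩
  have hrb : ∀ i, Below R' (D i \ R') := fun i x hx y hy =>
    hd.root_below (e i) x (hR'R hx) y (htail i hy)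
  have hmemR : ∀ i (a : Fin Q.card),
      (D i).orderEmbOfFin (hcard i) a ∈ R' ↔ (a : ℕ) < R'.card := fun i a =>
    orderEmbOfFin_mem_iff (hR'D i) (hrb i) (hcard i) a
  refine ⟨Q.card, hcard, R', ?_, ⟨hn, hinj, fun i i' hii => ?_, hrb, fun i i' hii => ?_⟩, ?_, ?_⟩
  · rw [← hcard i₀]
    exact Finset.card_pos.2 (hne i₀)
  · refine Finset.Subset.antisymm (fun x hx => ?_) (Finset.subset_inter (hR'D i) (hR'D i'))
    obtain ⟨hxi, hxi'⟩ := Finset.mem_inter.1 hx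
    rw [← hDR i]
    exact Finset.mem_inter.2
      ⟨hxi, hd.mem_root (heinj.ne hii) (hpart i hxi) (hpart i' hxi')⟩
  · rcases lt_or_gt_of_ne (heinj.ne hii) with hlt | hlt
    · exact Or.inl fun x hx y hy => hd.tails_below _ _ hlt x (htail i hx) y (htail i' hy)
    · exact Or.inr fun x hx y hy => hd.tails_below _ _ hlt x (htail i' hx) y (htail i hy)
  · intro i a
    split_ifs with ha
    · exact hF.Xi_root hs.mem_level hd (hR'R ((hmemR i a).2 ha))
    · rw [hF.Xi_tail hs.mem_level hd (i := e i), hs.val_eq]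
      exact htail i (Finset.mem_sdiff.2
        ⟨Finset.orderEmbOfFin_mem _ _ _, fun h => ha ((hmemR i a).1 h)⟩)
  · intro i i' hii a ha
    have hx : ∀ i, (D i).orderEmbOfFin (hcard i) a ∈ part (e i) \ R := fun i =>
      htail i (Finset.mem_sdiff.2
        ⟨Finset.orderEmbOfFin_mem _ _ _, fun h => absurd ((hmemR i a).1 h) (not_lt.2 ha)⟩)
    refine ⟨hF.rho_eq_of_tails hs.mem_level hd (heinj.ne hii.ne) (hx i) (hx i'),
      Del_eq_iff.2 ⟨?_, fun c hc => ?_⟩⟩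
    · have hA : ∀ i, (D i).orderEmbOfFin (hcard i) a ∈ A := fun i =>
        hd.mem_iff.2 ⟨e i, (Finset.mem_sdiff.1 (hx i)).1⟩
      intro h
      have h1 := hF.eq_of_cardFun_eq hs.mem_level (hA i) (hA i') h
      refine (Finset.mem_sdiff.1 (hx i)).2 (hd.mem_root (heinj.ne hii.ne)
        (Finset.mem_sdiff.1 (hx i)).1 ?_)
      rw [h1]
      exact (Finset.mem_sdiff.1 (hx i')).1
    · refine hF.cardFun_eq_of_le (Nat.lt_succ_iff.1 hc) ?_
      have hm : ∀ i, (D i).orderEmbOfFin (hcard i) a ∈ D i := fun i =>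
        Finset.orderEmbOfFin_mem _ _ _
      exact hF.cardFun_eq_of_closure hjk (hs.cardFun_eq i i') (hD i _ (hm i)).2 (hD i _ (hm i)).1
        (hD i' _ (hm i')).2 (hD i' _ (hm i')).1 (by rw [hval, hval])

/-! ### Projections of sets of ordinals -/

omit hF in
theorem _root_.Scheme.proj_mono {n : ℕ} {S T : Set OmegaOne} (h : S ⊆ T) :
    proj τ F n S ⊆ proj τ F n T := by
  rintro l ⟨α, hα, hc⟩
  exact ⟨α, fun i => h (hα i), hc⟩

omit hF in
theorem _root_.Scheme.proj_eq_empty {n : ℕ} (hn : 2 ≤ n) {S : Set OmegaOne}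
    (h : S.Subsingleton) : proj τ F n S = ∅ := by
  rw [Set.eq_empty_iff_forall_notMem]
  rintro l ⟨α, hα, hc⟩
  have hne : (⟨0, by omega⟩ : Fin n) ≠ ⟨1, by omega⟩ := by simp
  exact hne ((captured_singletons hc).1 (h (hα _) (hα _)))

omit hF in
theorem _root_.Scheme.finite_proj {n : ℕ} (hn : 2 ≤ n) (p : Finset OmegaOne) :
    (proj τ F n (p : Set OmegaOne)).Finite := by
  refine ((p ×ˢ p).image fun x => rho τ F x.1 x.2).finite_toSet.subset ?_
  rintro l ⟨α, hα, hc⟩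
  have hlt : (⟨0, by omega⟩ : Fin n) < ⟨1, by omega⟩ := by simp
  rw [Finset.mem_coe, Finset.mem_image]
  exact ⟨(α ⟨0, by omega⟩, α ⟨1, by omega⟩), Finset.mem_product.2 ⟨hα _, hα _⟩,
    ((captured_singletons hc).2.2 _ _ hlt).1⟩

omit hF in
/-- A level of the projection of `S` is a level of the projection of a finite subset of `S`. -/
theorem _root_.Scheme.exists_finset_mem_proj {n l : ℕ} {S : Set OmegaOne}
    (h : l ∈ proj τ F n S) : ∃ p : Finset OmegaOne, (p : Set OmegaOne) ⊆ S ∧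
      l ∈ proj τ F n (p : Set OmegaOne) := by
  obtain ⟨α, hα, hc⟩ := h
  refine ⟨Finset.univ.image α, ?_, α, fun i => by simp, hc⟩
  simpa using Set.range_subset_iff.2 hα

/-- The union of sets which occupy the same positions of the closures of captured points has no
new levels in its projection, except the one at which the points are captured. -/
theorem proj_biUnion_subset {n k j : ℕ} (hn : 2 ≤ n) (hjk : j ≤ k) {α : Fin n → OmegaOne}
    {A : Finset OmegaOne} {part : Fin (τ.n (k + 1)) → Finset OmegaOne} {R : Finset OmegaOne}
    {e : Fin n → Fin (τ.n (k + 1))} (hs : IsSpread τ F k α A part R e)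
    {p : Fin n → Finset OmegaOne} (hp : ∀ i, InClosure τ F j (α i) (p i)) {Q : Finset ℕ}
    (hQ : ∀ i, (p i).image (fun x => cardFun τ F x j) = Q) :
    proj τ F n (Finset.univ.biUnion p : Finset OmegaOne) ⊆
      insert (k + 1) (⋃ i, proj τ F n (p i : Set OmegaOne)) := by
  have hd := hs.decomposition
  have heinj : Function.Injective e := fun i i' h => Fin.ext (by
    rw [← hs.val_eq i, ← hs.val_eq i', h])
  have hpart : ∀ i, p i ⊆ part (e i) := fun i => hF.mem_part_of_inClosure hjk hs (hp i)
  rintro l ⟨β, hβ, hc⟩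
  have hβ' : ∀ t, ∃ i, β t ∈ p i := fun t => by simpa using hβ t
  obtain ⟨hinj, -, hrho⟩ := captured_singletons hc
  have hlk : l ≤ k + 1 := by
    have hlt : (⟨0, by omega⟩ : Fin n) < ⟨1, by omega⟩ := by simp
    rw [← (hrho _ _ hlt).1]
    have hA : ∀ t, β t ∈ A := fun t => by
      obtain ⟨i, hi⟩ := hβ' t
      exact hd.mem_iff.2 ⟨e i, hpart i hi⟩
    exact hF.rho_le_iff.2 ⟨A, hs.mem_level, hA _, hA _⟩
  rcases hlk.eq_or_lt with rfl | hlt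
  · exact Set.mem_insert _ _
  refine Set.mem_insert_of_mem _ (Set.mem_iUnion.2 ?_)
  have : Nonempty (Fin n) := ⟨⟨0, by omega⟩⟩
  obtain ⟨M, hM⟩ := Finite.exists_max β
  obtain ⟨i, hi⟩ := hβ' M
  refine ⟨i, β, fun t => ?_, hc⟩
  have hrho' : rho τ F (β M) (β t) ≤ l := by
    rcases lt_trichotomy M t with hij | rfl | hij
    · exact (hrho M t hij).1.le
    · rw [hF.rho_self]; exact Nat.zero_le _
    · rw [rho_comm]; exact (hrho t M hij).1.le
  -- For `l ≤ k` the largest point drags every `β t` into its own part. A `β t` coming from another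
  -- `p i'` is then a root point, and equality of positions puts it in `p i` too.
  have hti := hF.mem_of_rho_le (Nat.lt_succ_iff.1 hlt) hrho' (hM t) (hd.mem_level (e i))
    (hpart i hi)
  obtain ⟨i', hi'⟩ := hβ' t
  by_cases hii : i = i'
  · rw [hii]; exact hi'
  have hR := hd.mem_root (heinj.ne hii) hti (hpart i' hi')
  have hmem : cardFun τ F (β t) j ∈ (p i).image (fun x => cardFun τ F x j) := by
    rw [hQ i, ← hQ i']
    exact Finset.mem_image_of_mem _ hi'
  obtain ⟨y, hy, hxy⟩ := Finset.mem_image.1 hmem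
  rw [hF.root_inter_subset hjk hs (hp i') (hp i) hi' hy hR hxy.symm]
  exact hy

end IsConstructionScheme

/-- `Ψ` is a property of sets of levels which is inherited by subsets, and each finite set with the
property can be enlarged, keeping the property, by a level of the projection of any given
uncountable set. -/
structure IsExtendible (τ : GoodType) (F : Set (Finset OmegaOne)) (n : ℕ) (Ψ : Set ℕ → Prop) :
    Prop where
  empty : Ψ ∅
  mono : ∀ X Y, X ⊆ Y → Ψ Y → Ψ X
  extend : ∀ X : Set ℕ, X.Finite → Ψ X → ∀ S : Set OmegaOne, ¬ S.Countable →
    ∃ l ∈ proj τ F n S, Ψ (insert l X)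

/-! ### Amalgamation of uncountably many conditions -/

/-- A countable set of bounds would place all `d i` inside a countable initial segment, which has
only countably many finite subsets. -/
theorem not_countable_range_of_mem_le {I : Type} (hI : ¬ Countable I) (d : I → Finset OmegaOne)
    (hd : Function.Injective d) (α : I → OmegaOne) (hα : ∀ i, ∀ x ∈ d i, x ≤ α i) :
    ¬ (Set.range α).Countable := by
  intro h
  obtain ⟨ξ, hξ⟩ := exists_gt_of_countable h
  have hc := Set.countable_ofPred_finite_subset (countable_Iio ξ)
  have hmaps : ∀ i, ((d i : Set OmegaOne)) ∈ {t : Set OmegaOne | t.Finite ∧ t ⊆ Set.Iio ξ} :=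
    fun i => ⟨(d i).finite_toSet, fun x hx => (hα i x hx).trans_lt (hξ _ ⟨i, rfl⟩)⟩
  have := hc.to_subtype
  refine hI (Function.Injective.countable (f := fun i => (⟨_, hmaps i⟩ :
    {t : Set OmegaOne | t.Finite ∧ t ⊆ Set.Iio ξ})) fun i i' h => hd ?_)
  exact Finset.coe_injective (Subtype.ext_iff.1 h)

namespace IsConstructionScheme

variable (hF : IsConstructionScheme τ F)
include hF

/-- The `p i` are the conditions to be united and the `d i` the sets to be captured. Both are
encoded by the maximum of `p i ∪ d i`, so that extendibility, which speaks about points only,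
applies. -/
theorem exists_amalgam {n : ℕ} (hn : 2 ≤ n) {Ψ : Set ℕ → Prop} (hΨ : IsExtendible τ F n Ψ)
    {I : Type} (hI : ¬ Countable I) (p d : I → Finset OmegaOne) (hd : Function.Injective d)
    (hne : ∀ i, (d i).Nonempty) (hp : ∀ i, Ψ (proj τ F n (p i : Set OmegaOne))) (K : ℕ) :
    ∃ l > K, ∃ i : Fin n → I, Captured τ F (fun t => d (i t)) l ∧
      Ψ (proj τ F n (Finset.univ.biUnion fun t => p (i t) : Finset OmegaOne)) := by
  have hq : ∀ i, (p i ∪ d i).Nonempty := fun i => (hne i).inr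
  set α : I → OmegaOne := fun i => (p i ∪ d i).max' (hq i) with hα
  have hle : ∀ i, ∀ x ∈ p i ∪ d i, x ≤ α i := fun i x hx => Finset.le_max' _ _ hx
  have hunc : ¬ (Set.range α).Countable :=
    not_countable_range_of_mem_le hI d hd α fun i x hx => hle i x (Finset.mem_union_right _ hx)
  -- At level `κ i` the closure of `α i` contains `p i ∪ d i`; the maximum with `K` later gives `l >
  -- K`.
  set κ : I → ℕ := fun i => max K ((p i ∪ d i).sup fun x => rho τ F (α i) x) with hκ
  have hcl : ∀ i, InClosure τ F (κ i) (α i) (p i ∪ d i) := fun i x hx =>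
    ⟨hle i x hx, (Finset.le_sup (f := fun x => rho τ F (α i) x) hx).trans (le_max_right _ _)⟩
  set c : I → ℕ × ℕ × Finset ℕ × Finset ℕ × Finset ℕ := fun i =>
    (κ i, cardFun τ F (α i) (κ i), (p i).image (fun x => cardFun τ F x (κ i)),
      (d i).image (fun x => cardFun τ F x (κ i)), (finite_proj (τ := τ) (F := F) hn (p i)).toFinset)
    with hc
  obtain ⟨⟨j, v, P, D, X⟩, hS⟩ := exists_uncountable_image_fiber α hunc c
  have hci : ∀ i, c i = (j, v, P, D, X) → κ i = j ∧ cardFun τ F (α i) j = v ∧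
      (p i).image (fun x => cardFun τ F x j) = P ∧ (d i).image (fun x => cardFun τ F x j) = D ∧
      proj τ F n (p i : Set OmegaOne) = X := by
    intro i hi
    simp only [hc, Prod.mk.injEq] at hi
    obtain ⟨rfl, rfl, rfl, rfl, rfl⟩ := hi
    simp
  have hX : Ψ (X : Set ℕ) := by
    have : (α '' {i | c i = (j, v, P, D, X)}).Nonempty := by
      by_contra h
      rw [Set.not_nonempty_iff_eq_empty] at h
      exact hS (h ▸ Set.countable_empty)
    obtain ⟨_, i, hi, -⟩ := this
    rw [← (hci i hi).2.2.2.2]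
    exact hp i
  obtain ⟨l, ⟨β, hβ, hcap⟩, hl⟩ := hΨ.extend X X.finite_toSet hX _ hS
  choose i hi hβi using hβ
  obtain rfl : (fun t => α (i t)) = β := funext hβi
  obtain ⟨hinj, -, hrho⟩ := captured_singletons hcap
  -- The captured points agree at level `j`, hence at all lower ones, but differ at level `l`.
  have hjl : j < l := by
    by_contra! hlj
    have hlt : (⟨0, by omega⟩ : Fin n) < ⟨1, by omega⟩ := by simp
    refine (Del_eq_iff.1 (hrho _ _ hlt).2).1 (hF.cardFun_eq_of_le hlj ?_)
    rw [(hci _ (hi _)).2.1, (hci _ (hi _)).2.1]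
  obtain ⟨k, A, part, R, e, rfl, hs⟩ := hF.exists_isSpread hn hcap
  have hcl' : ∀ t, InClosure τ F j (α (i t)) (p (i t) ∪ d (i t)) := fun t =>
    (hci _ (hi t)).1 ▸ hcl (i t)
  refine ⟨k + 1, ?_, i, ?_, ?_⟩
  · have hK : K ≤ κ (i ⟨0, by omega⟩) := le_max_left _ _
    rw [(hci _ (hi _)).1] at hK
    exact hK.trans_lt hjl
  · refine hF.captured_of_isSpread hn (Nat.lt_succ_iff.1 hjl) hs
      (fun t => (hcl' t).mono Finset.subset_union_right) (fun t => (hci _ (hi t)).2.2.2.1)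
      (fun t t' h => hinj ?_) fun t => hne _
    exact congrArg α (hd h)
  · refine hΨ.mono _ _ (hF.proj_biUnion_subset hn (Nat.lt_succ_iff.1 hjl) hs
      (fun t => (hcl' t).mono Finset.subset_union_left) (fun t => (hci _ (hi t)).2.2.1)) ?_
    refine hΨ.mono _ _ (Set.insert_subset_insert (Set.iUnion_subset fun t => ?_)) hl
    rw [(hci _ (hi t)).2.2.2.2]

end IsConstructionScheme

/-! ### The forcing -/

/-- The forcing of finite sets `p ⊇ p₀` of ordinals whose projection has the property `Ψ`. -/
def Cond (τ : GoodType) (F : Set (Finset OmegaOne)) (n : ℕ) (Ψ : Set ℕ → Prop)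
    (p₀ : Finset OmegaOne) : Type :=
  {p : Finset OmegaOne // p₀ ⊆ p ∧ Ψ (proj τ F n (p : Set OmegaOne))}

instance (n : ℕ) (Ψ : Set ℕ → Prop) (p₀ : Finset OmegaOne) : Preorder (Cond τ F n Ψ p₀) where
  le p q := q.1 ⊆ p.1
  le_refl p := Finset.Subset.refl p.1
  le_trans _ _ _ h h' := Finset.Subset.trans h' h

namespace IsConstructionScheme

variable (hF : IsConstructionScheme τ F)
include hF

theorem isCCC_cond {n : ℕ} (hn : 2 ≤ n) {Ψ : Set ℕ → Prop} (hΨ : IsExtendible τ F n Ψ)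
    (p₀ : Finset OmegaOne) : IsCCC (Cond τ F n Ψ p₀) := by
  intro A hA
  by_contra hunc
  -- The amalgamation needs nonempty sets; at most one condition is empty.
  have hunc' : ¬ {a ∈ A | a.1.Nonempty}.Countable := fun h => by
    have hsub : {a ∈ A | ¬ a.1.Nonempty}.Subsingleton := fun a ha b hb => Subtype.ext (by
      rw [Finset.not_nonempty_iff_eq_empty.1 ha.2, Finset.not_nonempty_iff_eq_empty.1 hb.2])
    refine hunc ((h.union hsub.countable).mono fun a ha => ?_)
    by_cases hne : a.1.Nonempty
    · exact Or.inl ⟨ha, hne⟩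
    · exact Or.inr ⟨ha, hne⟩
  obtain ⟨l, -, i, hcap, hu⟩ := hF.exists_amalgam hn hΨ
    (I := {a : Cond τ F n Ψ p₀ | a ∈ A ∧ a.1.Nonempty}) hunc'
    (fun a => a.1.1) (fun a => a.1.1) (fun a b h => Subtype.ext (Subtype.ext h))
    (fun a => a.2.2) (fun a => a.1.2.2) 0
  obtain ⟨m, hm, R, -, hR, -⟩ := hcap
  have hne : (⟨0, by omega⟩ : Fin n) ≠ ⟨1, by omega⟩ := by simp
  have hsub : ∀ t, (i t).1.1 ⊆ Finset.univ.biUnion fun t => (i t).1.1 := fun t =>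
    Finset.subset_biUnion_of_mem (fun t => (i t).1.1) (Finset.mem_univ t)
  have hdist : (i ⟨0, by omega⟩).1 ≠ (i ⟨1, by omega⟩).1 := fun h =>
    hne (hR.injective (congrArg Subtype.val h))
  rcases hA (i ⟨0, by omega⟩).2.1 (i ⟨1, by omega⟩).2.1 hdist
    ⟨_, (i ⟨0, by omega⟩).1.2.1.trans (hsub _), hu⟩ with h | h
  · exact h (hsub _)
  · exact h (hsub _)

/-- The elements that conditions below `q'` can put into the named family form an uncountable ground
model set. Amalgamating the deciding conditions captures `n` of these elements and keeps a common
extension. -/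
theorem preserves_cond {n : ℕ} (hn : 2 ≤ n) {Ψ : Set ℕ → Prop} (hΨ : IsExtendible τ F n Ψ)
    (p₀ : Finset OmegaOne) : Preserves τ F (Cond τ F n Ψ p₀) n := by
  intro _ S q _ hS k q' hq'
  set E : Set (NFin OmegaOne) := {x | ∃ u ≤ q', ∃ s, u ≤ s ∧ (s, x) ∈ S} with hE
  have hEc : ¬ E.Countable := by
    intro hEc
    obtain ⟨f, hf⟩ := Set.countable_iff_exists_injOn.1 hEc
    -- If `E` were countable, the canonical name of the inverse of an injection `E → ℕ` would
    -- witness that the named family is countable.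
    refine hS q' hq' fun r hr => ⟨r, le_rfl, {z | z.2.2 ∈ E ∧ f z.2.2 = z.2.1}, ?_, ?_⟩
    · intro i x y r' _ hxy
      obtain ⟨_, _, _, _, hx, hfx⟩ := hxy.1 r' le_rfl
      obtain ⟨_, _, _, _, hy, hfy⟩ := hxy.2 r' le_rfl
      exact hf hx hy (hfx.trans hfy.symm)
    · intro x r' hr' hx r'' hr''
      obtain ⟨t, ht, s, hts, hsx⟩ := hx r'' hr''
      refine ⟨r'', le_rfl, f x, fun w _ => ⟨w, le_rfl, w, le_rfl, ?_, rfl⟩⟩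
      exact ⟨t, ht.trans (hr''.trans (hr'.trans hr)), s, hts, hsx⟩
  choose u hu s hus hsS using fun x : E => x.2
  obtain ⟨l, hl, i, hcap, hΨu⟩ := hF.exists_amalgam hn hΨ (I := E) hEc (fun x => (u x).1)
    (fun x => x.1.1) (fun x y h => Subtype.ext (Subtype.ext h)) (fun x => x.1.2)
    (fun x => (u x).2.2) k
  have hsub : ∀ t, (u (i t)).1 ⊆ Finset.univ.biUnion fun t => (u (i t)).1 := fun t =>
    Finset.subset_biUnion_of_mem (fun t => (u (i t)).1) (Finset.mem_univ t)
  let w : Cond τ F n Ψ p₀ := ⟨_, (u (i ⟨0, by omega⟩)).2.1.trans (hsub _), hΨu⟩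
  have hw : ∀ t, w ≤ u (i t) := hsub
  refine ⟨w, (hw ⟨0, by omega⟩).trans (hu _), l, hl, fun v hv => ⟨v, le_rfl, fun t => (i t).1,
    hcap, fun t v' hv' => ⟨v', le_rfl, s (i t), ?_, hsS (i t)⟩⟩⟩
  exact (hv'.trans (hv.trans (hw t))).trans (hus (i t))

/-- Some condition forces the generic set of ordinals to be unbounded. -/
theorem exists_unbounded_cond {n : ℕ} (hn : 2 ≤ n) {Ψ : Set ℕ → Prop}
    (hΨ : IsExtendible τ F n Ψ) : ∃ p₀ : Finset OmegaOne, Ψ (proj τ F n (p₀ : Set OmegaOne)) ∧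
      ∀ ξ : OmegaOne, ∀ q : Finset OmegaOne, p₀ ⊆ q → Ψ (proj τ F n (q : Set OmegaOne)) →
        ∃ r : Finset OmegaOne, q ⊆ r ∧ Ψ (proj τ F n (r : Set OmegaOne)) ∧ ∃ α ∈ r, ξ < α := by
  by_contra! hcon
  have hsing : ∀ α : OmegaOne, Ψ (proj τ F n (({α} : Finset OmegaOne) : Set OmegaOne)) := fun α => by
    rw [proj_eq_empty hn (by simp)]
    exact hΨ.empty
  -- If the claim fails, each `{α}` has an extension `q α` none of whose further extensions reaches
  -- beyond `ξ α`.
  choose ξ q hq hΨq hr using fun α : OmegaOne => hcon {α} (hsing α)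
  -- A maximal set spaced out by `ξ` is uncountable, since a countable one could be enlarged by a
  -- point above `X` and `ξ '' X`.
  obtain ⟨X, hX⟩ := zorn_subset {X : Set OmegaOne | ∀ α ∈ X, ∀ β ∈ X, α < β → ξ α < β} (by
    intro C hC hchain
    refine ⟨⋃₀ C, ?_, fun s hs => Set.subset_sUnion_of_mem hs⟩
    rintro α ⟨s, hs, hα⟩ β ⟨t, ht, hβ⟩ hlt
    rcases hchain.total hs ht with h | h
    · exact hC ht α (h hα) β hβ hlt
    · exact hC hs α hα β (h hβ) hlt)
  have hXc : ¬ X.Countable := by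
    intro hXc
    obtain ⟨η, hη⟩ := exists_gt_of_countable (hXc.union (hXc.image ξ))
    have hins : insert η X ∈ {X : Set OmegaOne | ∀ α ∈ X, ∀ β ∈ X, α < β → ξ α < β} := by
      rintro α (rfl | hα) β (rfl | hβ) hlt
      · exact absurd hlt (lt_irrefl _)
      · exact absurd hlt (hη β (Or.inl hβ)).not_gt
      · exact hη _ (Or.inr ⟨α, hα, rfl⟩)
      · exact hX.prop α hα β hβ hlt
    have := hX.le_of_ge hins (Set.subset_insert η X) (Set.mem_insert η X)
    exact lt_irrefl _ (hη η (Or.inl this))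
  obtain ⟨l, -, i, hcap, hu⟩ := hF.exists_amalgam hn hΨ (I := X) hXc (fun α => q α.1)
    (fun α => {α.1}) (fun α β h => Subtype.ext (Finset.singleton_injective h))
    (fun α => Finset.singleton_nonempty _) (fun α => hΨq α.1) 0
  have hsub : ∀ t, q (i t).1 ⊆ Finset.univ.biUnion fun t => q (i t).1 := fun t =>
    Finset.subset_biUnion_of_mem (fun t => q (i t).1) (Finset.mem_univ t)
  have hne : (⟨0, by omega⟩ : Fin n) ≠ ⟨1, by omega⟩ := by simp
  -- The amalgam extends `q (i a)` and contains `i b`, which lies above `ξ (i a)`.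
  have key : ∀ a b : Fin n, ¬ (i a).1 < (i b).1 := fun a b hlt =>
    absurd (hr (i a).1 _ (hsub a) hu (i b).1 (hsub b (hq _ (Finset.mem_singleton_self _))))
      (not_le.2 (hX.prop _ (i a).2 _ (i b).2 hlt))
  rcases lt_or_gt_of_ne ((captured_singletons hcap).1.ne hne) with h | h
  · exact key _ _ h
  · exact key _ _ h

/-- If the Martin number of the scheme is large, then for each extendible property there is an
uncountable set whose finite subsets all have a projection with the property. -/
theorem exists_uncountable_of_martin {n : ℕ} (hn : 2 ≤ n) (hcap : IsCapturing τ F n)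
    (hm : ((ℵ₁ : Cardinal.{0}) : WithTop Cardinal.{0}) < schemeMartinNumber τ F n)
    {Ψ : Set ℕ → Prop} (hΨ : IsExtendible τ F n Ψ) :
    ∃ S : Set OmegaOne, ¬ S.Countable ∧ ∀ p : Finset OmegaOne, (p : Set OmegaOne) ⊆ S →
      Ψ (proj τ F n (p : Set OmegaOne)) := by
  obtain ⟨p₀, hp₀, hub⟩ := hF.exists_unbounded_cond hn hΨ
  have hlt : ((ℵ₁ : Cardinal.{0}) : WithTop Cardinal.{0}) < martinNumber (Cond τ F n Ψ p₀) := by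
    rw [schemeMartinNumber, if_pos hcap] at hm
    refine hm.trans_le ?_
    exact iInf_le_of_le (Cond τ F n Ψ p₀) (iInf_le_of_le (inferInstance : Preorder _)
      (iInf_le_of_le ⟨⟨p₀, subset_rfl, hp₀⟩⟩ (iInf_le_of_le (hF.isCCC_cond hn hΨ p₀)
        (iInf_le_of_le (hF.preserves_cond hn hΨ p₀) le_rfl))))
  set E : OmegaOne → Set (Cond τ F n Ψ p₀) := fun ξ => {q | ∃ α ∈ q.1, ξ < α} with hE
  have hdense : ∀ D ∈ Set.range E, IsCoinitial D := by
    rintro _ ⟨ξ, rfl⟩ q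
    obtain ⟨r, hqr, hr, hα⟩ := hub ξ q.1 q.2.1 q.2.2
    exact ⟨⟨r, q.2.1.trans hqr, hr⟩, hα, hqr⟩
  have hG : ∃ G : Order.PFilter (Cond τ F n Ψ p₀), ∀ D ∈ Set.range E, ∃ p ∈ D, p ∈ G := by
    by_contra hG
    have hle : martinNumber (Cond τ F n Ψ p₀) ≤
        ((#(Set.range E) : Cardinal.{0}) : WithTop Cardinal.{0}) :=
      iInf₂_le (Set.range E) ⟨hdense, hG⟩
    have hle' : #(Set.range E) ≤ ℵ₁ := mk_omegaOne ▸ Cardinal.mk_range_le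
    exact absurd (hlt.trans_le hle) (not_lt.2 (WithTop.coe_le_coe.2 hle'))
  obtain ⟨G, hG⟩ := hG
  refine ⟨{α | ∃ p ∈ G, α ∈ p.1}, fun hc => ?_, fun p hp => ?_⟩
  · obtain ⟨ξ, hξ⟩ := exists_gt_of_countable hc
    obtain ⟨g, ⟨α, hα, hlt'⟩, hgG⟩ := hG _ ⟨ξ, rfl⟩
    exact absurd (hξ α ⟨g, hgG, hα⟩) hlt'.not_gt
  -- By directedness a single condition of the filter covers all of the finite set `p`.
  · have hex : ∃ g ∈ G, p ⊆ g.1 := by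
      induction p using Finset.induction_on with
      | empty =>
        obtain ⟨g, hg⟩ := G.nonempty
        exact ⟨g, hg, Finset.empty_subset _⟩
      | insert a p _ ih =>
        rw [Finset.coe_insert, Set.insert_subset_iff] at hp
        obtain ⟨g, hg, hpg⟩ := ih hp.2
        obtain ⟨g', hg', ha⟩ := hp.1
        obtain ⟨g'', hg'', h1, h2⟩ := G.directed g hg g' hg'
        exact ⟨g'', hg'', Finset.insert_subset (h2 ha) (hpg.trans h1)⟩
    obtain ⟨g, -, hpg⟩ := hex
    exact hΨ.mono _ _ (proj_mono (Finset.coe_subset.2 hpg)) g.2.2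

/-! ### The projection filter -/

omit hF in
theorem _root_.Scheme.IsCapturing.exists_mem_proj {n : ℕ} (hcap : IsCapturing τ F n)
    {S : Set OmegaOne} (hS : ¬ S.Countable) (k : ℕ) : ∃ l ∈ proj τ F n S, k < l := by
  obtain ⟨l, hl, D, hD, hDS⟩ := hcap
    ((fun α => (⟨{α}, Finset.singleton_nonempty α⟩ : NFin OmegaOne)) '' S) (fun hc => hS
      (Set.countable_of_injective_of_countable_image (fun α _ β _ h =>
        Finset.singleton_injective (congrArg Subtype.val h)) hc)) k
  choose α hα hαD using hDS
  refine ⟨l, ⟨α, hα, ?_⟩, hl⟩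
  have : (fun i => ({α i} : Finset OmegaOne)) = fun i => (D i).1 :=
    funext fun i => congrArg Subtype.val (hαD i)
  rw [this]
  exact hD

/-- Fixing the value `‖x‖_k` makes all points agree up to level `k`, so `Del` exceeds `k` for any
two of them. -/
theorem exists_uncountable_subset_proj_gt {n : ℕ} (hn : 2 ≤ n) {S : Set OmegaOne}
    (hS : ¬ S.Countable) (k : ℕ) :
    ∃ S' ⊆ S, ¬ S'.Countable ∧ ∀ l ∈ proj τ F n S', k < l := by
  obtain ⟨v, hv⟩ := exists_uncountable_image_fiber (fun x : S => x.1)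
    (by rwa [Subtype.range_coe]) (fun x => cardFun τ F x.1 k)
  refine ⟨_, ?_, hv, ?_⟩
  · rintro _ ⟨x, -, rfl⟩
    exact x.2
  rintro l ⟨α, hα, hc⟩
  have hlt : (⟨0, by omega⟩ : Fin n) < ⟨1, by omega⟩ := by simp
  have hval : ∀ i, cardFun τ F (α i) k = v := fun i => by
    obtain ⟨x, hx, hxα⟩ := hα i
    rw [← hxα]
    exact hx
  by_contra! hlk
  exact (Del_eq_iff.1 ((captured_singletons hc).2.2 _ _ hlt).2).1
    (hF.cardFun_eq_of_le hlk (by rw [hval, hval]))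

/-- Each `x ∈ T` is placed below a point `f x ∈ S`. Once the level joining the two and the position
of `x` there are constant, a capture of the `f x` at a higher level is also one of the `x`. -/
theorem exists_proj_subset_inter {n : ℕ} (hn : 2 ≤ n) {S T : Set OmegaOne} (hS : ¬ S.Countable)
    (hT : ¬ T.Countable) :
    ∃ S' : Set OmegaOne, ¬ S'.Countable ∧ proj τ F n S' ⊆ proj τ F n S ∩ proj τ F n T := by
  choose f hfS hlt using exists_gt_of_not_countable hS
  have hrange : ¬ (Set.range fun x : T => f x.1).Countable := by
    intro h
    obtain ⟨ξ, hξ⟩ := exists_gt_of_countable h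
    obtain ⟨x, hx, hξx⟩ := exists_gt_of_not_countable hT ξ
    exact absurd ((hξ _ ⟨⟨x, hx⟩, rfl⟩).trans hξx) (hlt x).not_gt
  obtain ⟨⟨k, v, w⟩, hunc⟩ := exists_uncountable_image_fiber _ hrange fun x =>
    (rho τ F (f x.1) x.1, cardFun τ F (f x.1) (rho τ F (f x.1) x.1),
      cardFun τ F x.1 (rho τ F (f x.1) x.1))
  obtain ⟨S', hsub, hS', hgt⟩ := hF.exists_uncountable_subset_proj_gt hn hunc k
  refine ⟨S', hS', ?_⟩
  rintro l ⟨α, hα, hc⟩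
  have hkl : k < l := hgt l ⟨α, hα, hc⟩
  choose x hx hxα using fun i => hsub (hα i)
  have hinj := (captured_singletons hc).1
  refine ⟨⟨α, fun i => hxα i ▸ hfS _, hc⟩, fun i => (x i).1, fun i => (x i).2, ?_⟩
  obtain ⟨k', A, part, R, e, rfl, hs⟩ := hF.exists_isSpread hn hc
  simp only [Set.mem_ofPred_eq, Prod.mk.injEq] at hx
  refine hF.captured_of_isSpread hn (Nat.lt_succ_iff.1 hkl) hs (D := fun i => {(x i).1})
    (Q := {w}) (fun i y hy => ?_) (fun i => ?_) (fun i i' h => hinj ?_)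
    fun i => Finset.singleton_nonempty _
  · obtain rfl := Finset.mem_singleton.1 hy
    rw [← hxα i]
    exact ⟨(hlt _).le, (hx i).1.le⟩
  · rw [Finset.image_singleton, ← (hx i).2.2, (hx i).1]
  · rw [← hxα i, ← hxα i']
    exact congrArg f (Finset.singleton_injective h)

/-- The filter `𝒰_n(F)`. -/
def projectionFilter {n : ℕ} (hn : 2 ≤ n) : Filter ℕ where
  sets := projFilter τ F n
  univ_sets := ⟨Set.univ, not_countable_univ, Set.subset_univ _⟩
  sets_of_superset := by
    rintro A B ⟨S, hS, hA⟩ hAB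
    exact ⟨S, hS, hA.trans hAB⟩
  inter_sets := by
    rintro A B ⟨S, hS, hA⟩ ⟨T, hT, hB⟩
    obtain ⟨S', hS', h⟩ := hF.exists_proj_subset_inter hn hS hT
    exact ⟨S', hS', h.trans (Set.inter_subset_inter hA hB)⟩

/-! ### The ultrafilter and its Ramsey property -/

theorem projFilter_compl_notMem_iff {n : ℕ} (hn : 2 ≤ n) (hcap : IsCapturing τ F n)
    (hm : ((ℵ₁ : Cardinal.{0}) : WithTop Cardinal.{0}) < schemeMartinNumber τ F n) (A : Set ℕ) :
    Aᶜ ∉ hF.projectionFilter hn ↔ A ∈ hF.projectionFilter hn := by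
  constructor
  · intro h
    have hΨ : IsExtendible τ F n (fun X => X ⊆ A) := by
      refine ⟨Set.empty_subset _, fun _ _ h h' => h.trans h', fun X _ hX S hS => ?_⟩
      by_contra! hcon
      -- An uncountable set whose projection misses `A` would put `Aᶜ` into the filter.
      exact h ⟨S, hS, fun l hl hlA => hcon l hl (Set.insert_subset hlA hX)⟩
    obtain ⟨S, hS, hp⟩ := hF.exists_uncountable_of_martin hn hcap hm hΨ
    refine ⟨S, hS, fun l hl => ?_⟩
    obtain ⟨p, hpS, hlp⟩ := exists_finset_mem_proj hl
    exact hp p hpS hlp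
  · rintro hA hAc
    obtain ⟨S, hS, h⟩ := (hF.projectionFilter hn).inter_mem hA hAc
    obtain ⟨l, hl, -⟩ := hcap.exists_mem_proj hS 0
    exact (h hl).2 (h hl).1

/-- The ultrafilter `𝒰_n(F)`. -/
def projectionUltrafilter {n : ℕ} (hn : 2 ≤ n) (hcap : IsCapturing τ F n)
    (hm : ((ℵ₁ : Cardinal.{0}) : WithTop Cardinal.{0}) < schemeMartinNumber τ F n) :
    Ultrafilter ℕ :=
  Ultrafilter.ofComplNotMemIff (hF.projectionFilter hn) (hF.projFilter_compl_notMem_iff hn hcap hm)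

theorem mem_projectionUltrafilter {n : ℕ} (hn : 2 ≤ n) (hcap : IsCapturing τ F n)
    (hm : ((ℵ₁ : Cardinal.{0}) : WithTop Cardinal.{0}) < schemeMartinNumber τ F n) {A : Set ℕ} :
    A ∈ hF.projectionUltrafilter hn hcap hm ↔ A ∈ projFilter τ F n := Iff.rfl

theorem isRamsey_projectionUltrafilter {n : ℕ} (hn : 2 ≤ n) (hcap : IsCapturing τ F n)
    (hm : ((ℵ₁ : Cardinal.{0}) : WithTop Cardinal.{0}) < schemeMartinNumber τ F n) :
    IsRamsey (hF.projectionUltrafilter hn hcap hm) := by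
  refine ⟨fun k => ?_, fun Q _ hQ hQU => ?_⟩
  · rw [mem_projectionUltrafilter]
    obtain ⟨S, -, hS, hgt⟩ :=
      hF.exists_uncountable_subset_proj_gt hn (τ := τ) (F := F) not_countable_univ k
    exact ⟨S, hS, fun l hl => (hgt l hl).ne'⟩
  have hΨ : IsExtendible τ F n (fun X => ∀ B ∈ Q, (X ∩ B).Subsingleton) := by
    refine ⟨by simp, fun X Y hXY hY B hB => (hY B hB).anti (Set.inter_subset_inter_left _ hXY),
      fun X hXf hX S hS => ?_⟩
    -- The levels outside the blocks of the finitely many elements of `X` form a set in the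
    -- ultrafilter; any such level can be added to the selector `X`.
    have hU : ⋂ x ∈ X, {l : ℕ | ∀ B ∈ Q, x ∈ B → l ∉ B} ∈ hF.projectionUltrafilter hn hcap hm := by
      refine (Filter.biInter_mem hXf).2 fun x _ => ?_
      obtain ⟨B, ⟨hB, hxB⟩, huniq⟩ := hQ.2 x
      refine Filter.mem_of_superset (hQU B hB) fun l hl B' hB' hxB' => ?_
      rw [huniq B' ⟨hB', hxB'⟩]
      exact hl
    obtain ⟨T, hT, hTsub⟩ := (hF.mem_projectionUltrafilter hn hcap hm).1 hU
    obtain ⟨S', hS', hsub⟩ := hF.exists_proj_subset_inter hn hS hT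
    obtain ⟨l, hl, -⟩ := hcap.exists_mem_proj hS' 0
    have hlX : ∀ x ∈ X, ∀ B ∈ Q, x ∈ B → l ∉ B := fun x hx =>
      Set.mem_iInter₂.1 (hTsub (hsub hl).2) x hx
    refine ⟨l, (hsub hl).1, fun B hB => ?_⟩
    rintro x ⟨rfl | hx, hxB⟩ y ⟨rfl | hy, hyB⟩
    · rfl
    · exact absurd hxB (hlX y hy B hB hyB)
    · exact absurd hyB (hlX x hx B hB hxB)
    · exact hX B hB ⟨hx, hxB⟩ ⟨hy, hyB⟩
  obtain ⟨S, hS, hp⟩ := hF.exists_uncountable_of_martin hn hcap hm hΨ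
  refine ⟨proj τ F n S, (hF.mem_projectionUltrafilter hn hcap hm).2 ⟨S, hS, subset_rfl⟩, ?_⟩
  rintro B hB x ⟨hx, hxB⟩ y ⟨hy, hyB⟩
  obtain ⟨p, hpS, hxp⟩ := exists_finset_mem_proj hx
  obtain ⟨q, hqS, hyq⟩ := exists_finset_mem_proj hy
  -- Two levels in one block are witnessed together by a finite subset of `S`, whose projection
  -- meets each block at most once.
  refine hp (p ∪ q) (by rw [Finset.coe_union]; exact Set.union_subset hpS hqS) B hB ⟨?_, hxB⟩
    ⟨?_, hyB⟩
  · exact proj_mono (Finset.coe_subset.2 Finset.subset_union_left) hxp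
  · exact proj_mono (Finset.coe_subset.2 Finset.subset_union_right) hyq

end IsConstructionScheme

end Scheme
end

theorem mainTheorem9 (n : ℕ) (hn : 2 ≤ n) (τ : Scheme.GoodType)
    (F : Set (Finset Scheme.OmegaOne)) (hF : Scheme.IsConstructionScheme τ F)
    (hcap : Scheme.IsCapturing τ F n)
    (hm : ((ℵ₁ : Cardinal.{0}) : WithTop Cardinal.{0}) < Scheme.schemeMartinNumber τ F n) :
    ∃ U : Ultrafilter ℕ, {A : Set ℕ | A ∈ U} = Scheme.projFilter τ F n ∧ Scheme.IsRamsey U :=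
  ⟨hF.projectionUltrafilter hn hcap hm, rfl, hF.isRamsey_projectionUltrafilter hn hcap hm⟩
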